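/- Let $\mathbf Q$ be the class of functions $q\in C^2([0,1])$ with values in $[0,1]$ and $\max_{i=0,1,2}\max_{x\in[0,1]}|q^{(i)}(x)|\le 1$. Call $\mu\in\mathbb R$ an eigenvalue for $q$ if $-u''(x)+q(x)u(x)=\mu u(x)$ on $(0,1)$ for some $u\in C^2([0,1])$, $u\not\equiv 0$, with $u(0)=u(1)=0$; let $\lambda(q)$ be the smallest eigenvalue. A (deterministic, adaptive) algorithm $\phi$ evaluates $q$ at $n_q$ points $t_i\in[0,1]$, where each point, the decision to stop, and the output $\phi(q)$ depend only on the values of $q$ obtained before. Its worst case error is $\sup_{q\in\mathbf Q}|\lambda(q)-\phi(q)|$. Let $n^{\mathrm{wor}}(\varepsilon)$ be the minimum of $\sup_{q\in\mathbf Q}n_q$ over all algorithms (arbitrary functions of the computed values) with worst case error at most $\varepsilon$. In the real number model with an oracle (computation trees using constants, exact arithmetic operations, elementary functions and comparisons, each operation at unit cost, and evaluations of $q$ at computed points of $[0,1]$ at cost $c>0$ each), let $\mathrm{comp}^{\mathrm{wor}}(\varepsilon)$ be the minimum of the worst case cost $\sup_{q\in\mathbf Q}(c\,n_q+m_q)$,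 where $m_q$ is the number of operations, over all algorithms in this model with worst case error at most $\varepsilon$. For $n\ge1$ let $M_q$ be the $n\times n$ symmetric tridiagonal matrix with diagonal entries $2(n+1)^2+q(\tfrac{i}{n+1})$, $i=1,\dots,n$, and off-diagonal entries $-(n+1)^2$, and let $\lambda_1(M_q)$ be its smallest eigenvalue. **Theorem.** Every $q\in\mathbf Q$ has a smallest eigenvalue $\lambda(q)$. There is a constant $C>0$ with $|\lambda(q)-\lambda_1(M_q)|\le C n^{-2}$ for all $n\ge 1$ and $q\in\mathbf Q$. There are positive constants $\alpha_1,\alpha_2,\alpha_3,\varepsilon_0$, independent of $\varepsilon$ and $c$, such that for all $0<\varepsilon\le\varepsilon_0$ and all $c>0$ $$\alpha_1\varepsilon^{-1/2}\le n^{\mathrm{wor}}(\varepsilon)\le\alpha_2\varepsilon^{-1/2},$$ $$\alpha_1\,c\,\varepsilon^{-1/2}\le \mathrm{comp}^{\mathrm{wor}}(\varepsilon)\le\alpha_2\,c\,\varepsilon^{-1/2}+\alpha_3\,\varepsilon^{-1/2}\log_2\varepsilon^{-1}.$$ Moreover, for each such $\varepsilon$ there are integers $n\ge 1$, $k\ge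 0$ with $n\le\alpha_2\varepsilon^{-1/2}$ and $k\le\alpha_3\log_2\varepsilon^{-1}$ for which the following algorithm has worst case error at most $\varepsilon$ and can be carried out in the above model with exactly $n$ evaluations of $q$ and at most $\alpha_3\varepsilon^{-1/2}\log_2\varepsilon^{-1}$ operations for every $q\in\mathbf Q$: starting from the interval $[0,11]$, perform $k$ bisection steps, each keeping the right half of the current interval if all terms of the Sturm sequence of $M_q$ at its midpoint $x$ (the leading principal minors of $M_q-xI$ of orders $0,\dots,n$, computed by their three-term recurrence) are positive, and the left half otherwise; output the midpoint of the final interval. -/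

import Mathlib

noncomputable section

namespace SturmLiouville

open Set
open scoped ENNReal

/-! ### The eigenvalue problem -/

/-- The class of potentials: twice continuously differentiable functions `q : [0,1] → [0,1]`
with `max_{i=0,1,2} max_{x ∈ [0,1]} |q⁽ⁱ⁾(x)| ≤ 1`. A function on `[0,1]` is represented by a
function on `ℝ`, whose values outside `[0,1]` play no role below. -/
def potentials : Set (ℝ → ℝ) :=
  {q | ContDiffOn ℝ 2 q (Icc 0 1) ∧ MapsTo q (Icc 0 1) (Icc 0 1) ∧
    ∀ i ≤ 2, ∀ x ∈ Icc (0 : ℝ) 1, |iteratedDerivWithin i q (Icc 0 1) x| ≤ 1}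

/-- `u` is an eigenfunction with eigenvalue `μ` of `u ↦ -u'' + q u` on `(0,1)` with the
boundary conditions `u(0) = u(1) = 0`: it is a `C²([0,1])` function, not identically zero. -/
structure IsEigenfunction (q : ℝ → ℝ) (μ : ℝ) (u : ℝ → ℝ) : Prop where
  contDiffOn : ContDiffOn ℝ 2 u (Icc 0 1)
  nonzero : ∃ x ∈ Icc (0 : ℝ) 1, u x ≠ 0
  left : u 0 = 0
  right : u 1 = 0
  equation : ∀ x ∈ Ioo (0 : ℝ) 1,
    -iteratedDerivWithin 2 u (Icc 0 1) x + q x * u x = μ * u x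

/-- The eigenvalues of the Sturm–Liouville problem with potential `q`. -/
def eigenvalues (q : ℝ → ℝ) : Set ℝ := {μ | ∃ u, IsEigenfunction q μ u}

/-- The smallest eigenvalue `λ(q)`. -/
def smallestEigenvalue (q : ℝ → ℝ) : ℝ := sInf (eigenvalues q)

/-! ### Adaptive deterministic algorithms and the information complexity -/

/-- A deterministic algorithm that uses function values, with arbitrary (not necessarily
computable) dependence on them: it either stops with an output, or it evaluates the input
function at a point of `[0,1]` and continues in a way that depends on the value obtained.
So the sample points, their number and the output are arbitrary functions of the values
computed before. -/
inductive SamplingAlgorithm : Type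
  | output (y : ℝ) : SamplingAlgorithm
  | sample (t : Icc (0 : ℝ) 1) (next : ℝ → SamplingAlgorithm) : SamplingAlgorithm

namespace SamplingAlgorithm

/-- The output `φ(q)`. -/
def value (q : ℝ → ℝ) : SamplingAlgorithm → ℝ
  | output y => y
  | sample t next => value q (next (q t))

/-- The number `n_q` of function values used for `q`. -/
def evals (q : ℝ → ℝ) : SamplingAlgorithm → ℕ
  | output _ => 0
  | sample t next => evals q (next (q t)) + 1

/-- The worst case error `sup_q |λ(q) - φ(q)|`. -/
def worstError (φ : SamplingAlgorithm) : ℝ≥0∞ :=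
  ⨆ q ∈ potentials, ENNReal.ofReal |smallestEigenvalue q - φ.value q|

/-- The number `n = sup_q n_q` of function values used in the worst case. -/
def worstEvals (φ : SamplingAlgorithm) : ℕ∞ :=
  ⨆ q ∈ potentials, (φ.evals q : ℕ∞)

end SamplingAlgorithm

/-- The worst case information complexity: the minimal number of function values with which
some algorithm achieves worst case error at most `ε`. -/
def nWor (ε : ℝ) : ℕ∞ :=
  ⨅ (φ : SamplingAlgorithm) (_ : φ.worstError ≤ ENNReal.ofReal ε), φ.worstEvals

/-! ### The real number model with an oracle and the complexity -/

/-- An operand of an instruction: the content of a register, or a real constant. -/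
inductive Operand : Type
  | reg (i : ℕ) : Operand
  | const (a : ℝ) : Operand

/-- The value of an operand when the registers hold `s`. -/
def Operand.value (s : ℕ → ℝ) : Operand → ℝ
  | reg i => s i
  | const a => a

/-- The four arithmetic operations. -/
inductive ArithOp : Type
  | add | sub | mul | div

open Classical in
/-- The result of an arithmetic operation; division by zero is undefined. -/
def ArithOp.eval : ArithOp → ℝ → ℝ → Option ℝ
  | add, x, y => some (x + y)
  | sub, x, y => some (x - y)
  | mul, x, y => some (x * y)
  | div, x, y => if y = 0 then none else some (x / y)

/-- The elementary functions that can be evaluated at unit cost. -/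
inductive ElemFun : Type
  | sqrt | exp | log | sin | cos | tan | arcsin | arccos | arctan

open Classical in
/-- The value of an elementary function, undefined outside its domain. -/
def ElemFun.eval : ElemFun → ℝ → Option ℝ
  | sqrt, x => if 0 ≤ x then some (Real.sqrt x) else none
  | exp, x => some (Real.exp x)
  | log, x => if 0 < x then some (Real.log x) else none
  | sin, x => some (Real.sin x)
  | cos, x => some (Real.cos x)
  | tan, x => if Real.cos x ≠ 0 then some (Real.tan x) else none
  | arcsin, x => if x ∈ Icc (-1 : ℝ) 1 then some (Real.arcsin x) else none
  | arccos, x => if x ∈ Icc (-1 : ℝ) 1 then some (Real.arccos x) else none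
  | arctan, x => some (Real.arctan x)

/-- An algorithm in the real number model with an oracle for function values, written as a
(finite) computation tree: arithmetic operations and elementary functions on exact real
numbers in registers, branching on comparisons, and evaluations of the input function at
computed points. `dst` is the register that receives the result of an instruction. -/
inductive ComputationTree : Type
  | output (a : Operand) : ComputationTree
  | arith (dst : ℕ) (f : ArithOp) (a b : Operand) (next : ComputationTree) : ComputationTree
  | elem (dst : ℕ) (f : ElemFun) (a : Operand) (next : ComputationTree) : ComputationTree
  | compare (a b : Operand) (ifLE ifGT : ComputationTree) : ComputationTree
  | sample (dst : ℕ) (t : Operand) (next : ComputationTree) : ComputationTree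

/-- What a successful computation produces: its output, the number of function evaluations and
the number of arithmetic operations, elementary functions and comparisons performed. -/
structure Outcome : Type where
  value : ℝ
  evals : ℕ
  ops : ℕ

/-- Count one more operation. -/
def Outcome.addOp (r : Outcome) : Outcome := ⟨r.value, r.evals, r.ops + 1⟩

/-- Count one more function evaluation. -/
def Outcome.addEval (r : Outcome) : Outcome := ⟨r.value, r.evals + 1, r.ops⟩

namespace ComputationTree

open Classical in
/-- Run a computation on the input function `q`, starting with register contents `s`. The
computation fails (`none`) when it performs an undefined operation or asks for a value of `q`
outside `[0,1]`. -/
def run (q : ℝ → ℝ) : ComputationTree → (ℕ → ℝ) → Option Outcome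
  | output a, s => some ⟨a.value s, 0, 0⟩
  | arith dst f a b next, s =>
      (f.eval (a.value s) (b.value s)).bind fun y =>
        (run q next (Function.update s dst y)).map Outcome.addOp
  | elem dst f a next, s =>
      (f.eval (a.value s)).bind fun y =>
        (run q next (Function.update s dst y)).map Outcome.addOp
  | compare a b ifLE ifGT, s =>
      (if a.value s ≤ b.value s then run q ifLE s else run q ifGT s).map Outcome.addOp
  | sample dst t next, s =>
      if t.value s ∈ Icc (0 : ℝ) 1 then
        (run q next (Function.update s dst (q (t.value s)))).map Outcome.addEval
      else none

/-- The result of the computation on `q`, all registers being `0` at the start. -/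
def exec (T : ComputationTree) (q : ℝ → ℝ) : Option Outcome := T.run q fun _ => 0

/-- The worst case error `sup_q |λ(q) - φ(q)|`, infinite if the computation fails for some
potential. -/
def worstError (T : ComputationTree) : ℝ≥0∞ :=
  ⨆ q ∈ potentials, (T.exec q).elim ⊤ fun r => ENNReal.ofReal |smallestEigenvalue q - r.value|

/-- The worst case cost `sup_q (c n_q + m_q)`, infinite if the computation fails for some
potential. -/
def worstCost (c : ℝ) (T : ComputationTree) : ℝ≥0∞ :=
  ⨆ q ∈ potentials, (T.exec q).elim ⊤ fun r => ENNReal.ofReal c * (r.evals : ℝ≥0∞) + (r.ops : ℝ≥0∞)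

end ComputationTree

/-- The worst case complexity: the minimal worst case cost of an algorithm with worst case
error at most `ε`, when one function evaluation costs `c`. -/
def compWor (c ε : ℝ) : ℝ≥0∞ :=
  ⨅ (T : ComputationTree) (_ : T.worstError ≤ ENNReal.ofReal ε), T.worstCost c

/-! ### The finite difference matrix and bisection with Sturm sequences -/

/-- The `n × n` finite difference matrix `M_q`: it is tridiagonal with diagonal entries
`2 (n+1)² + q(i/(n+1))`, `i = 1, …, n`, and off-diagonal entries `-(n+1)²`. -/
def fdMatrix (n : ℕ) (q : ℝ → ℝ) : Matrix (Fin n) (Fin n) ℝ := fun i j =>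
  if i = j then 2 * ((n : ℝ) + 1) ^ 2 + q (((i : ℕ) + 1 : ℝ) / ((n : ℝ) + 1))
  else if (i : ℕ) + 1 = j ∨ (j : ℕ) + 1 = i then -((n : ℝ) + 1) ^ 2
  else 0

/-- The smallest eigenvalue of `M_q`. -/
def fdEigenvalue (n : ℕ) (q : ℝ → ℝ) : ℝ := sInf (spectrum ℝ (fdMatrix n q))

/-- The Sturm sequence of `M_q` at `x`, given by the three-term recurrence for the leading
principal minors of `M_q - x I`. -/
def sturmSeq (n : ℕ) (q : ℝ → ℝ) (x : ℝ) : ℕ → ℝ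
  | 0 => 1
  | 1 => 2 * ((n : ℝ) + 1) ^ 2 + q (1 / ((n : ℝ) + 1)) - x
  | k + 2 =>
      (2 * ((n : ℝ) + 1) ^ 2 + q (((k : ℝ) + 2) / ((n : ℝ) + 1)) - x) * sturmSeq n q x (k + 1)
        - ((n : ℝ) + 1) ^ 4 * sturmSeq n q x k

open Classical in
/-- The interval after `k` bisection steps for the smallest eigenvalue of `M_q`, starting from
`[0, 11]`: the right half is kept if the Sturm sequence at the midpoint has no sign change
(all its `n + 1` terms are positive), the left half otherwise. -/
def bisectionInterval (n : ℕ) (q : ℝ → ℝ) : ℕ → ℝ × ℝ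
  | 0 => (0, 11)
  | k + 1 =>
      let I := bisectionInterval n q k
      let m := (I.1 + I.2) / 2
      if ∀ j ≤ n, 0 < sturmSeq n q m j then (m, I.2) else (I.1, m)

/-- The output of the bisection algorithm: the midpoint of the last interval. -/
def sturmBisection (n k : ℕ) (q : ℝ → ℝ) : ℝ :=
  ((bisectionInterval n q k).1 + (bisectionInterval n q k).2) / 2

end SturmLiouville

end

noncomputable section

namespace SturmLiouville

open Set Filter Topology
open scoped ENNReal

/-! Everything rests on a ground state: an eigenfunction u that is positive on (0,1). In Prüfer
coordinates u = ρ sin θ, u' = ρ cos θ, the angle at 1 is continuous in the spectral parameter, is at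
most 1 for μ = 1 and at least π for μ = 11, so it equals π for some μ. Since θ crosses multiples of
π only upwards, the corresponding u is positive inside. Picone's identity turns positivity into the
variational inequality ∫ v'² + (q - μ)v² ≥ 0 for all v vanishing at 0 and 1
(`IsGroundState.integral_nonneg`), and therefore μ is the least eigenvalue. Concavity of u supplies
the uniform bound u ≥ x(1 - x), on which all later estimates depend.

Accuracy of the matrix: u restricted to the grid satisfies the eigenvalue equation of M_q up to
O(n⁻²). Adding or subtracting a multiple of x(1 - x) of that size absorbs the defect and gives a
positive supersolution and a subsolution. The discrete maximum principle `le_fdEigenvalue` and the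
Rayleigh principle `fdEigenvalue_le` turn these into two-sided bounds. The same two principles,
applied to truncated Sturm sequences, show that all Sturm terms at x are positive exactly when x
lies below the smallest eigenvalue, so bisection converges to it.

Upper bounds: choose n of order ε^(-1/2) and k of order log ε⁻¹, and write the bisection as an
explicit computation tree with counted operations. Lower bounds: an adversary answers 1 to every
query. After N queries at least N + 1 of about 4N cells in the middle of the interval are untouched;
lowering the potential there by C² bumps of height of order N⁻² lowers the eigenvalue by order N⁻²
(`exists_fooling_potential`), unseen by the algorithm. Computation trees are covered because
forgetting their operations leaves a sampling algorithm. -/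

/-! ### Existence of a positive eigenfunction by the Prüfer transformation -/

/-- `u` solves the equation of the eigenvalue problem on `[0,1]`, and `u₁` is its derivative. -/
structure IsSolution (q : ℝ → ℝ) (μ : ℝ) (u u₁ : ℝ → ℝ) : Prop where
  hasDeriv : ∀ x ∈ Icc (0 : ℝ) 1, HasDerivWithinAt u (u₁ x) (Icc 0 1) x
  hasDeriv₂ : ∀ x ∈ Icc (0 : ℝ) 1, HasDerivWithinAt u₁ ((q x - μ) * u x) (Icc 0 1) x

lemma hasDerivWithinAt_Ici_of_Icc {f : ℝ → ℝ} {f' a b x : ℝ}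
    (h : HasDerivWithinAt f f' (Icc a b) x) (hx : x ∈ Ico a b) :
    HasDerivWithinAt f f' (Ici x) x :=
  h.mono_of_mem_nhdsWithin (Icc_mem_nhdsGE_of_mem hx)

/-- `θ` is the Prüfer angle of the solutions that vanish at `0`. -/
structure IsPruferAngle (q : ℝ → ℝ) (μ : ℝ) (θ : ℝ → ℝ) : Prop where
  zero : θ 0 = 0
  hasDeriv : ∀ t ∈ Icc (0 : ℝ) 1,
    HasDerivWithinAt θ (1 + (μ - q t - 1) * Real.sin (θ t) ^ 2) (Icc 0 1) t

lemma abs_sin_sq_sub_sin_sq_le (a b : ℝ) :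
    |Real.sin a ^ 2 - Real.sin b ^ 2| ≤ |a - b| := by
  have h : Real.sin a ^ 2 - Real.sin b ^ 2 = Real.sin (a + b) * Real.sin (a - b) := by
    rw [Real.sin_add, Real.sin_sub]
    nlinarith [Real.sin_sq_add_cos_sq a, Real.sin_sq_add_cos_sq b]
  rw [h, abs_mul]
  calc |Real.sin (a + b)| * |Real.sin (a - b)| ≤ 1 * |a - b| := by
        exact mul_le_mul (Real.abs_sin_le_one _) Real.abs_sin_le_abs (abs_nonneg _) zero_le_one
    _ = _ := one_mul _

section Prufer

variable {q : ℝ → ℝ} {μ : ℝ}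

lemma lipschitz_pruferField {a : ℝ} (ha : |a| ≤ 10) :
    LipschitzWith 10 fun x : ℝ => 1 + a * Real.sin x ^ 2 := by
  refine LipschitzWith.of_dist_le_mul fun x y => ?_
  rw [Real.dist_eq, Real.dist_eq]
  have : 1 + a * Real.sin x ^ 2 - (1 + a * Real.sin y ^ 2)
      = a * (Real.sin x ^ 2 - Real.sin y ^ 2) := by ring
  rw [this, abs_mul]
  have h := abs_sin_sq_sub_sin_sq_le x y
  have : ((10 : NNReal) : ℝ) = 10 := rfl
  rw [this]
  gcongr

lemma abs_pruferCoeff_le (hq : MapsTo q (Icc 0 1) (Icc 0 1)) (hμ : μ ∈ Icc (1 : ℝ) 11) {t : ℝ}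
    (ht : t ∈ Icc (0 : ℝ) 1) : |μ - q t - 1| ≤ 10 := by
  have := hq ht
  rw [abs_le]; constructor <;> linarith [this.1, this.2, hμ.1, hμ.2]

lemma exists_isPruferAngle (hc : ContinuousOn q (Icc 0 1)) (hq : MapsTo q (Icc 0 1) (Icc 0 1))
    (hμ : μ ∈ Icc (1 : ℝ) 11) : ∃ θ, IsPruferAngle q μ θ := by
  -- The field is bounded by 11 and the time span is 1, so a ball of radius 11 holds the trajectory
  -- on all of [0,1].
  have hpl : IsPicardLindelof (fun t x : ℝ => 1 + (μ - q t - 1) * Real.sin x ^ 2)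
      (⟨0, by simp⟩ : Icc (0 : ℝ) 1) 0 11 0 11 10 := by
    refine ⟨fun t ht => (lipschitz_pruferField (abs_pruferCoeff_le hq hμ ht)).lipschitzOnWith,
      fun x _ => ?_, fun t ht x _ => ?_, ?_⟩
    · fun_prop
    · have h := abs_pruferCoeff_le hq hμ ht
      have hs : Real.sin x ^ 2 ≤ 1 := Real.sin_sq_le_one x
      have hs0 := sq_nonneg (Real.sin x)
      have : ((11 : NNReal) : ℝ) = 11 := rfl
      rw [Real.norm_eq_abs, this]
      calc |1 + (μ - q t - 1) * Real.sin x ^ 2| ≤ |1| + |(μ - q t - 1) * Real.sin x ^ 2| :=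
            abs_add_le _ _
        _ = 1 + |μ - q t - 1| * Real.sin x ^ 2 := by rw [abs_one, abs_mul, abs_of_nonneg hs0]
        _ ≤ 1 + 10 * 1 := by gcongr
        _ = 11 := by norm_num
    · simp
  obtain ⟨θ, h0, h⟩ := hpl.exists_eq_forall_mem_Icc_hasDerivWithinAt₀
  exact ⟨θ, h0, h⟩

lemma IsPruferAngle.continuousOn {θ : ℝ → ℝ} (h : IsPruferAngle q μ θ) :
    ContinuousOn θ (Icc 0 1) := fun x hx => (h.hasDeriv x hx).continuousWithinAt

/-- The angle crosses multiples of `π` only upwards. -/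
lemma IsPruferAngle.lt_of_le {θ : ℝ → ℝ} (h : IsPruferAngle q μ θ)
    (hq : MapsTo q (Icc 0 1) (Icc 0 1)) (hμ : μ ∈ Icc (1 : ℝ) 11) {k : ℤ} {a b : ℝ}
    (ha : 0 ≤ a) (hab : a < b) (hb : b ≤ 1) (hk : k * Real.pi ≤ θ a) :
    k * Real.pi < θ b := by
  have hsub : Icc a b ⊆ Icc 0 1 := Icc_subset_Icc ha hb
  -- The line kπ + (x - a)/100 is a lower barrier: it stays within 1/100 of kπ, so at a contact
  -- point sin² θ ≤ 10⁻⁴ and θ' ≥ 1 - 10 · 10⁻⁴, which exceeds the slope 1/100.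
  have key : ∀ x ∈ Icc a b, -θ x ≤ -(k * Real.pi + (1 / 100) * (x - a)) := by
    refine image_le_of_deriv_right_lt_deriv_boundary'
      (f' := fun t => -(1 + (μ - q t - 1) * Real.sin (θ t) ^ 2))
      (B' := fun _ => -((1 / 100) * 1)) (h.continuousOn.mono hsub).neg ?_ ?_ ?_ ?_ ?_
    · intro x hx
      exact (hasDerivWithinAt_Ici_of_Icc (h.hasDeriv x (hsub ⟨hx.1, hx.2.le⟩))
        ⟨ha.trans hx.1, hx.2.trans_le hb⟩).neg
    · simpa using hk
    · fun_prop
    · intro x _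
      exact ((((hasDerivWithinAt_id x (Ici x)).sub_const a).const_mul (1 / 100 : ℝ)).const_add
        (k * Real.pi)).neg
    · intro x hx hcontact
      have hθ : θ x = (1 / 100) * (x - a) + k * Real.pi := by
        rw [Pi.neg_apply] at hcontact; linarith
      have hs : Real.sin (θ x) ^ 2 ≤ (1 / 100) ^ 2 := by
        rw [hθ, Real.sin_add_int_mul_pi, mul_pow]
        have h1 : ((-1 : ℝ) ^ k) ^ 2 = 1 := by
          rw [← zpow_natCast, ← zpow_mul, mul_comm, zpow_mul]; norm_num
        rw [h1, one_mul]
        rw [sq_le_sq]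
        refine Real.abs_sin_le_abs.trans ?_
        have h0 : 0 ≤ x - a := by linarith [hx.1]
        rw [abs_of_nonneg (by positivity), abs_of_nonneg (by norm_num)]
        linarith [hx.2]
      have hcf := abs_le.1 (abs_pruferCoeff_le hq hμ (hsub ⟨hx.1, hx.2.le⟩))
      nlinarith [sq_nonneg (Real.sin (θ x)), hcf.1]
  have := key b ⟨hab.le, le_rfl⟩
  linarith

lemma IsPruferAngle.pos {θ : ℝ → ℝ} (h : IsPruferAngle q μ θ)
    (hq : MapsTo q (Icc 0 1) (Icc 0 1)) (hμ : μ ∈ Icc (1 : ℝ) 11) {t : ℝ} (ht : t ∈ Ioc (0 : ℝ) 1) :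
    0 < θ t := by
  simpa using h.lt_of_le (k := 0) hq hμ le_rfl ht.1 ht.2 (by simp [h.zero])

lemma IsPruferAngle.lt_pi {θ : ℝ → ℝ} (h : IsPruferAngle q μ θ)
    (hq : MapsTo q (Icc 0 1) (Icc 0 1)) (hμ : μ ∈ Icc (1 : ℝ) 11) (h1 : θ 1 ≤ Real.pi) {t : ℝ}
    (ht : t ∈ Ico (0 : ℝ) 1) : θ t < Real.pi := by
  by_contra! hle
  have := h.lt_of_le (k := 1) hq hμ ht.1 ht.2 le_rfl (by simpa using hle)
  simp at this
  linarith

/-- The solution with a given Prüfer angle. -/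
lemma IsPruferAngle.exists_isSolution {θ : ℝ → ℝ} (h : IsPruferAngle q μ θ)
    (hc : ContinuousOn q (Icc 0 1)) :
    ∃ ρ : ℝ → ℝ, (∀ t, 0 < ρ t) ∧
      IsSolution q μ (fun t => ρ t * Real.sin (θ t)) (fun t => ρ t * Real.cos (θ t)) := by
  -- The system forces ρ'/ρ = g. The extension `G` is continuous on ℝ, so its primitive is
  -- differentiable at the endpoints as well.
  set g : ℝ → ℝ := fun t => (1 + q t - μ) * (Real.sin (θ t) * Real.cos (θ t)) with hg
  have hgc : ContinuousOn g (Icc 0 1) := by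
    have := h.continuousOn
    exact (by fun_prop : ContinuousOn (fun t => 1 + q t - μ) (Icc 0 1)).mul
      ((Real.continuous_sin.comp_continuousOn this).mul (Real.continuous_cos.comp_continuousOn this))
  set G := IccExtend (zero_le_one' ℝ) ((Icc 0 1).domRestrict g) with hG
  have hGc : Continuous G := hgc.domRestrict.Icc_extend'
  have hGg : ∀ t ∈ Icc (0 : ℝ) 1, G t = g t := fun t ht => by
    rw [hG, IccExtend_of_mem _ _ ht]; rfl
  refine ⟨fun t => Real.exp (∫ s in (0 : ℝ)..t, G s), fun t => Real.exp_pos _, ?_⟩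
  have hρ : ∀ t ∈ Icc (0 : ℝ) 1, HasDerivWithinAt (fun t => Real.exp (∫ s in (0 : ℝ)..t, G s))
      (Real.exp (∫ s in (0 : ℝ)..t, G s) * g t) (Icc 0 1) t := fun t ht => by
    have := (hGc.integral_hasStrictDerivAt 0 t).hasDerivAt.exp
    rw [hGg t ht] at this
    exact this.hasDerivWithinAt
  refine ⟨fun t ht => ?_, fun t ht => ?_⟩
  · refine ((hρ t ht).mul (h.hasDeriv t ht).sin).congr_deriv ?_
    simp only [hg]
    have := Real.sin_sq_add_cos_sq (θ t)
    have h2 : Real.sin (θ t) ^ 2 = 1 - Real.cos (θ t) ^ 2 := by linarith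
    ring_nf
  · refine ((hρ t ht).mul (h.hasDeriv t ht).cos).congr_deriv ?_
    simp only [hg]
    have := Real.sin_sq_add_cos_sq (θ t)
    have h2 : Real.cos (θ t) ^ 2 = 1 - Real.sin (θ t) ^ 2 := by linarith
    ring_nf
    simp only [h2]
    ring_nf

/-- The angle at `1` depends continuously on the spectral parameter. -/
lemma continuousOn_pruferAngle_one (hq : MapsTo q (Icc 0 1) (Icc 0 1)) {Θ : ℝ → ℝ → ℝ}
    (hΘ : ∀ μ ∈ Icc (1 : ℝ) 11, IsPruferAngle q μ (Θ μ)) :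
    ContinuousOn (fun μ => Θ μ 1) (Icc 1 11) := by
  intro μ hμ
  have hb : ∀ ν ∈ Icc (1 : ℝ) 11, dist (Θ ν 1) (Θ μ 1) ≤ gronwallBound 0 10 |ν - μ| 1 := by
    intro ν hν
    -- Grönwall: `Θ ν` solves the equation for μ up to a defect of at most |ν - μ|, and both angles
    -- start at 0.
    have key := dist_le_of_approx_trajectories_ODE_of_mem (K := 10) (a := 0) (b := 1) (δ := 0)
      (v := fun t x => 1 + (μ - q t - 1) * Real.sin x ^ 2) (s := fun _ => univ)
      (f := Θ ν) (g := Θ μ) (f' := fun t => 1 + (ν - q t - 1) * Real.sin (Θ ν t) ^ 2)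
      (g' := fun t => 1 + (μ - q t - 1) * Real.sin (Θ μ t) ^ 2) (εf := |ν - μ|) (εg := 0)
      (fun t ht => (lipschitz_pruferField
        (abs_pruferCoeff_le hq hμ ⟨ht.1, ht.2.le⟩)).lipschitzOnWith)
      (hΘ ν hν).continuousOn
      (fun t ht => hasDerivWithinAt_Ici_of_Icc ((hΘ ν hν).hasDeriv t ⟨ht.1, ht.2.le⟩) ht)
      (fun t ht => ?_) (fun _ _ => trivial) (hΘ μ hμ).continuousOn
      (fun t ht => hasDerivWithinAt_Ici_of_Icc ((hΘ μ hμ).hasDeriv t ⟨ht.1, ht.2.le⟩) ht)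
      (fun t ht => by simp) (fun _ _ => trivial) (by rw [(hΘ ν hν).zero, (hΘ μ hμ).zero]; simp)
      1 (by simp)
    · simpa using key
    · rw [Real.dist_eq]
      have : 1 + (ν - q t - 1) * Real.sin (Θ ν t) ^ 2 - (1 + (μ - q t - 1) * Real.sin (Θ ν t) ^ 2)
          = (ν - μ) * Real.sin (Θ ν t) ^ 2 := by ring
      rw [this, abs_mul, abs_of_nonneg (sq_nonneg (Real.sin (Θ ν t)))]
      exact mul_le_of_le_one_right (abs_nonneg _) (Real.sin_sq_le_one _)
  rw [ContinuousWithinAt, tendsto_iff_dist_tendsto_zero]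
  have hlim : Tendsto (fun ν => gronwallBound 0 10 |ν - μ| 1) (𝓝[Icc 1 11] μ) (𝓝 0) := by
    have : Continuous fun ν => gronwallBound 0 10 |ν - μ| 1 :=
      (gronwallBound_continuous_ε 0 10 1).comp (by fun_prop)
    have h2 := (this.tendsto μ).mono_left (nhdsWithin_le_nhds (s := Icc 1 11))
    simpa [gronwallBound_ε0_δ0] using h2
  exact squeeze_zero' (Eventually.of_forall fun _ => dist_nonneg)
    (eventually_nhdsWithin_of_forall hb) hlim

lemma IsPruferAngle.one_le_one {θ : ℝ → ℝ} (h : IsPruferAngle q 1 θ)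
    (hq : MapsTo q (Icc 0 1) (Icc 0 1)) : θ 1 ≤ 1 := by
  refine image_le_of_deriv_right_le_deriv_boundary (a := 0) (b := 1) (B := id) (B' := fun _ => 1)
    h.continuousOn (fun x hx => hasDerivWithinAt_Ici_of_Icc (h.hasDeriv x ⟨hx.1, hx.2.le⟩) hx)
    (by simp [h.zero]) continuousOn_id (fun x _ => hasDerivWithinAt_id _ _) ?_ (x := 1) (by simp)
  intro x hx
  have := (hq ⟨hx.1, hx.2.le⟩).1
  nlinarith [sq_nonneg (Real.sin (θ x))]

lemma pi_sq_lt_ten : Real.pi ^ 2 < 10 := by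
  nlinarith [Real.pi_lt_d2, Real.pi_pos]

/-- Sturm comparison with sin(πt). If θ(1) < π, then u > 0 on (0,1], and the Wronskian W has W' = (q
- 11 + π²) u sin(πt) ≤ 0, because q ≤ 1 and π² < 10. But W(0) = 0 and W(1) = π u(1) > 0. -/
lemma IsPruferAngle.pi_le_one {θ : ℝ → ℝ} (h : IsPruferAngle q 11 θ)
    (hq : MapsTo q (Icc 0 1) (Icc 0 1)) (hc : ContinuousOn q (Icc 0 1)) : Real.pi ≤ θ 1 := by
  by_contra! hlt
  have hμ : (11 : ℝ) ∈ Icc (1 : ℝ) 11 := by norm_num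
  obtain ⟨ρ, hρ, hu⟩ := h.exists_isSolution hc
  set u := fun t => ρ t * Real.sin (θ t)
  set u₁ := fun t => ρ t * Real.cos (θ t)
  have hpos : ∀ t ∈ Ioc (0 : ℝ) 1, 0 < u t := fun t ht => by
    refine mul_pos (hρ t) (Real.sin_pos_of_pos_of_lt_pi (h.pos hq hμ ht) ?_)
    rcases ht.2.lt_or_eq with h1 | rfl
    · exact h.lt_pi hq hμ hlt.le ⟨ht.1.le, h1⟩
    · exact hlt
  have hs : ∀ t : ℝ, HasDerivAt (fun t => Real.sin (Real.pi * t))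
      (Real.cos (Real.pi * t) * Real.pi) t := fun t => by
    simpa using ((hasDerivAt_id t).const_mul Real.pi).sin
  have hs1 : ∀ t : ℝ, HasDerivAt (fun t => Real.cos (Real.pi * t) * Real.pi)
      (-Real.sin (Real.pi * t) * Real.pi * Real.pi) t := fun t => by
    simpa using (((hasDerivAt_id t).const_mul Real.pi).cos).mul_const Real.pi
  set W := fun t => u₁ t * Real.sin (Real.pi * t) - u t * (Real.cos (Real.pi * t) * Real.pi)
    with hW
  have hWd : ∀ t ∈ Icc (0 : ℝ) 1, HasDerivWithinAt W
      ((q t - 11 + Real.pi ^ 2) * (u t * Real.sin (Real.pi * t))) (Icc 0 1) t := fun t ht => by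
    refine (((hu.hasDeriv₂ t ht).mul (hs t).hasDerivWithinAt).sub
      ((hu.hasDeriv t ht).mul (hs1 t).hasDerivWithinAt)).congr_deriv ?_
    ring
  have hanti : AntitoneOn W (Icc 0 1) := by
    refine antitoneOn_of_hasDerivWithinAt_nonpos (convex_Icc 0 1)
      (fun x hx => (hWd x hx).continuousWithinAt)
      (fun x hx => (hWd x (interior_subset hx)).mono interior_subset) fun x hx => ?_
    rw [interior_Icc] at hx
    have h1 := (hq ⟨hx.1.le, hx.2.le⟩).2
    have h2 := pi_sq_lt_ten
    have h3 := hpos x ⟨hx.1, hx.2.le⟩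
    have h4 : 0 < Real.sin (Real.pi * x) := Real.sin_pos_of_pos_of_lt_pi
      (mul_pos Real.pi_pos hx.1) (by nlinarith [Real.pi_pos, hx.2])
    exact mul_nonpos_of_nonpos_of_nonneg (by linarith) (by positivity)
  have h01 := hanti (left_mem_Icc.2 zero_le_one) (right_mem_Icc.2 zero_le_one) zero_le_one
  have h0 : u 0 = 0 := by simp [u, h.zero]
  have h1 := hpos 1 (by simp)
  simp only [hW, mul_zero, Real.sin_zero, h0, mul_one, Real.sin_pi, Real.cos_pi, zero_mul] at h01
  nlinarith [Real.pi_pos]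

/-- Existence of an eigenvalue in `[1, 11]` with an eigenfunction that is positive in `(0,1)`. -/
lemma exists_positive_isSolution (hc : ContinuousOn q (Icc 0 1))
    (hq : MapsTo q (Icc 0 1) (Icc 0 1)) :
    ∃ μ ∈ Icc (1 : ℝ) 11, ∃ u u₁, IsSolution q μ u u₁ ∧ u 0 = 0 ∧ u 1 = 0 ∧
      ∀ x ∈ Ioo (0 : ℝ) 1, 0 < u x := by
  have hex : ∀ μ : ℝ, ∃ θ, μ ∈ Icc (1 : ℝ) 11 → IsPruferAngle q μ θ := fun μ => by
    by_cases hμ : μ ∈ Icc (1 : ℝ) 11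
    · obtain ⟨θ, h⟩ := exists_isPruferAngle hc hq hμ
      exact ⟨θ, fun _ => h⟩
    · exact ⟨0, fun h => absurd h hμ⟩
  choose Θ hΘ using hex
  have h1 := (hΘ 1 (by norm_num)).one_le_one hq
  have h11 := (hΘ 11 (by norm_num)).pi_le_one hq hc
  obtain ⟨μ, hμ, hμπ⟩ := intermediate_value_Icc (by norm_num : (1 : ℝ) ≤ 11)
    (continuousOn_pruferAngle_one hq hΘ)
    (show Real.pi ∈ Icc _ _ from ⟨by linarith [Real.pi_gt_three], h11⟩)
  obtain ⟨ρ, hρ, hu⟩ := (hΘ μ hμ).exists_isSolution hc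
  have hμπ' : Θ μ 1 = Real.pi := hμπ
  refine ⟨μ, hμ, _, _, hu, by simp [(hΘ μ hμ).zero], by simp [hμπ'], fun x hx => ?_⟩
  exact mul_pos (hρ x) (Real.sin_pos_of_pos_of_lt_pi ((hΘ μ hμ).pos hq hμ ⟨hx.1, hx.2.le⟩)
    ((hΘ μ hμ).lt_pi hq hμ hμπ'.le ⟨hx.1.le, hx.2⟩))

end Prufer

/-! ### One-sided calculus on `[0,1]` -/

lemma uniqueDiffOn_unitInterval : UniqueDiffOn ℝ (Icc (0 : ℝ) 1) := uniqueDiffOn_Icc zero_lt_one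

lemma iteratedDerivWithin_one_two_eq {f f₁ f₂ : ℝ → ℝ}
    (h₁ : ∀ x ∈ Icc (0 : ℝ) 1, HasDerivWithinAt f (f₁ x) (Icc 0 1) x)
    (h₂ : ∀ x ∈ Icc (0 : ℝ) 1, HasDerivWithinAt f₁ (f₂ x) (Icc 0 1) x) :
    EqOn (iteratedDerivWithin 1 f (Icc 0 1)) f₁ (Icc 0 1) ∧
      EqOn (iteratedDerivWithin 2 f (Icc 0 1)) f₂ (Icc 0 1) := by
  have e1 : EqOn (iteratedDerivWithin 1 f (Icc 0 1)) f₁ (Icc 0 1) := fun x hx => by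
    rw [iteratedDerivWithin_one]
    exact (h₁ x hx).derivWithin (uniqueDiffOn_unitInterval x hx)
  refine ⟨e1, fun x hx => ?_⟩
  rw [iteratedDerivWithin_succ, derivWithin_congr e1 (e1 hx)]
  exact (h₂ x hx).derivWithin (uniqueDiffOn_unitInterval x hx)

lemma contDiffOn_two_of_hasDerivWithinAt {f f₁ f₂ : ℝ → ℝ}
    (h₁ : ∀ x ∈ Icc (0 : ℝ) 1, HasDerivWithinAt f (f₁ x) (Icc 0 1) x)
    (h₂ : ∀ x ∈ Icc (0 : ℝ) 1, HasDerivWithinAt f₁ (f₂ x) (Icc 0 1) x)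
    (hc : ContinuousOn f₂ (Icc 0 1)) : ContDiffOn ℝ 2 f (Icc 0 1) := by
  have e0 : iteratedDerivWithin 0 f (Icc 0 1) = f := iteratedDerivWithin_zero
  obtain ⟨e1, e2⟩ := iteratedDerivWithin_one_two_eq h₁ h₂
  refine (contDiffOn_nat_iff_continuousOn_differentiableOn_deriv (n := 2)
    uniqueDiffOn_unitInterval).2 ⟨fun m hm => ?_, fun m hm => ?_⟩
  · interval_cases m
    · rw [e0]; exact fun x hx => (h₁ x hx).continuousWithinAt
    · exact ContinuousOn.congr (fun x hx => (h₂ x hx).continuousWithinAt) e1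
    · exact hc.congr e2
  · interval_cases m
    · rw [e0]; exact fun x hx => (h₁ x hx).differentiableWithinAt
    · exact DifferentiableOn.congr (fun x hx => (h₂ x hx).differentiableWithinAt) e1

lemma hasDerivWithinAt_of_contDiffOn_two {f : ℝ → ℝ} (h : ContDiffOn ℝ 2 f (Icc 0 1)) :
    (∀ x ∈ Icc (0 : ℝ) 1,
      HasDerivWithinAt f (iteratedDerivWithin 1 f (Icc 0 1) x) (Icc 0 1) x) ∧
    (∀ x ∈ Icc (0 : ℝ) 1, HasDerivWithinAt (iteratedDerivWithin 1 f (Icc 0 1))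
      (iteratedDerivWithin 2 f (Icc 0 1) x) (Icc 0 1) x) ∧
    ContinuousOn (iteratedDerivWithin 2 f (Icc 0 1)) (Icc 0 1) := by
  obtain ⟨hc, hd⟩ := (contDiffOn_nat_iff_continuousOn_differentiableOn_deriv (n := 2)
    uniqueDiffOn_unitInterval).1 h
  refine ⟨fun x hx => ?_, fun x hx => ?_, hc 2 le_rfl⟩
  · have := (hd 0 (by norm_num) x hx).hasDerivWithinAt
    rwa [← iteratedDerivWithin_succ, iteratedDerivWithin_zero] at this
  · have := (hd 1 (by norm_num) x hx).hasDerivWithinAt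
    rwa [← iteratedDerivWithin_succ] at this

lemma abs_sub_le_of_hasDerivWithinAt {f f' : ℝ → ℝ} {C : ℝ}
    (h : ∀ x ∈ Icc (0 : ℝ) 1, HasDerivWithinAt f (f' x) (Icc 0 1) x)
    (hC : ∀ x ∈ Icc (0 : ℝ) 1, |f' x| ≤ C) {x y : ℝ} (hx : x ∈ Icc (0 : ℝ) 1)
    (hy : y ∈ Icc (0 : ℝ) 1) : |f y - f x| ≤ C * |y - x| :=
  (convex_Icc (0 : ℝ) 1).norm_image_sub_le_of_norm_hasDerivWithin_le h hC hx hy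

lemma IsSolution.continuousOn {q : ℝ → ℝ} {μ : ℝ} {u u₁ : ℝ → ℝ} (h : IsSolution q μ u u₁) :
    ContinuousOn u (Icc 0 1) := fun x hx => (h.hasDeriv x hx).continuousWithinAt

lemma IsSolution.continuousOn₁ {q : ℝ → ℝ} {μ : ℝ} {u u₁ : ℝ → ℝ} (h : IsSolution q μ u u₁) :
    ContinuousOn u₁ (Icc 0 1) := fun x hx => (h.hasDeriv₂ x hx).continuousWithinAt

lemma IsSolution.isEigenfunction {q : ℝ → ℝ} {μ : ℝ} {u u₁ : ℝ → ℝ} (h : IsSolution q μ u u₁)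
    (hq : ContinuousOn q (Icc 0 1)) (h0 : u 0 = 0) (h1 : u 1 = 0)
    (hne : ∃ x ∈ Icc (0 : ℝ) 1, u x ≠ 0) : IsEigenfunction q μ u where
  contDiffOn := contDiffOn_two_of_hasDerivWithinAt h.hasDeriv h.hasDeriv₂ (by
    have := h.continuousOn
    fun_prop)
  nonzero := hne
  left := h0
  right := h1
  equation x hx := by
    rw [(iteratedDerivWithin_one_two_eq h.hasDeriv h.hasDeriv₂).2 ⟨hx.1.le, hx.2.le⟩]
    ring

/-- The equation is only assumed on the open interval; both sides are continuous on [0,1], so it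
extends to the endpoints. -/
lemma IsEigenfunction.isSolution {q : ℝ → ℝ} {μ : ℝ} {u : ℝ → ℝ} (h : IsEigenfunction q μ u)
    (hq : ContinuousOn q (Icc 0 1)) :
    IsSolution q μ u (iteratedDerivWithin 1 u (Icc 0 1)) := by
  obtain ⟨h1, h2, hc⟩ := hasDerivWithinAt_of_contDiffOn_two h.contDiffOn
  refine ⟨h1, fun x hx => ?_⟩
  have hu : ContinuousOn u (Icc 0 1) := fun x hx => (h1 x hx).continuousWithinAt
  have heq : EqOn (iteratedDerivWithin 2 u (Icc 0 1)) (fun x => (q x - μ) * u x) (Icc 0 1) := by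
    have hIoo : EqOn (iteratedDerivWithin 2 u (Icc 0 1)) (fun x => (q x - μ) * u x) (Ioo 0 1) :=
      fun y hy => by
        have := h.equation y hy
        simp only
        linarith
    refine hIoo.of_subset_closure hc (by fun_prop) Ioo_subset_Icc_self ?_
    rw [closure_Ioo zero_ne_one]
  rw [← show _ = (q x - μ) * u x from heq hx]
  exact h2 x hx

/-! ### Ground states -/

/-- A positive eigenfunction `u` with derivative `u₁`, normalised to have maximum `1`. -/
structure IsGroundState (q : ℝ → ℝ) (μ : ℝ) (u u₁ : ℝ → ℝ) : Prop
    extends IsSolution q μ u u₁ where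
  left : u 0 = 0
  right : u 1 = 0
  mem_Icc : μ ∈ Icc (1 : ℝ) 11
  le_one : ∀ x ∈ Icc (0 : ℝ) 1, u x ≤ 1
  le_self : ∀ x ∈ Icc (0 : ℝ) 1, x * (1 - x) ≤ u x
  abs_deriv_le : ∀ x ∈ Icc (0 : ℝ) 1, |u₁ x| ≤ 11

section

variable {q : ℝ → ℝ} {μ : ℝ} {u u₁ : ℝ → ℝ}

lemma IsGroundState.nonneg (h : IsGroundState q μ u u₁) {x : ℝ} (hx : x ∈ Icc (0 : ℝ) 1) :
    0 ≤ u x := (mul_nonneg hx.1 (sub_nonneg.2 hx.2)).trans (h.le_self x hx)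

lemma IsGroundState.pos (h : IsGroundState q μ u u₁) {x : ℝ} (hx : x ∈ Ioo (0 : ℝ) 1) :
    0 < u x := (mul_pos hx.1 (sub_pos.2 hx.2)).trans_le (h.le_self x ⟨hx.1.le, hx.2.le⟩)

/-- Since q ≤ 1 ≤ μ, u'' = (q - μ)u ≤ 0 and u is concave. The chords from the endpoints to the
maximum (m, 1) lie below the graph, whence u ≥ min(x, 1 - x) ≥ x(1 - x). As u'(m) = 0 and |u''| ≤
11, also |u'| ≤ 11. -/
lemma exists_isGroundState (hc : ContinuousOn q (Icc 0 1)) (hq : MapsTo q (Icc 0 1) (Icc 0 1)) :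
    ∃ μ u u₁, IsGroundState q μ u u₁ := by
  obtain ⟨μ, hμ, v, v₁, hv, hv0, hv1, hvpos⟩ := exists_positive_isSolution hc hq
  obtain ⟨m, hm, hmax⟩ := isCompact_Icc.exists_isMaxOn (nonempty_Icc.2 zero_le_one)
    hv.continuousOn
  have hM : 0 < v m := (hvpos (1 / 2) (by norm_num)).trans_le (hmax (by norm_num))
  have hm0 : 0 < m := hm.1.lt_of_ne (by rintro rfl; exact hM.ne' hv0)
  have hm1 : m < 1 := hm.2.lt_of_ne (by rintro rfl; exact hM.ne' hv1)
  set u : ℝ → ℝ := fun x => v x / v m with hu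
  set u₁ : ℝ → ℝ := fun x => v₁ x / v m with hu₁
  have hsol : IsSolution q μ u u₁ := ⟨fun x hx => (hv.hasDeriv x hx).div_const _, fun x hx =>
    ((hv.hasDeriv₂ x hx).div_const _).congr_deriv (by simp only [hu]; ring)⟩
  have hle : ∀ x ∈ Icc (0 : ℝ) 1, u x ≤ 1 := fun x hx => (div_le_one hM).2 (hmax hx)
  have hum : u m = 1 := div_self hM.ne'
  have hu0 : u 0 = 0 := by simp [hu, hv0]
  have hu1 : u 1 = 0 := by simp [hu, hv1]
  have hnn : ∀ x ∈ Icc (0 : ℝ) 1, 0 ≤ u x := fun x hx => by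
    rcases hx.1.eq_or_lt with rfl | h0
    · exact hu0.ge
    rcases hx.2.eq_or_lt with rfl | h1
    · exact hu1.ge
    exact (div_pos (hvpos x ⟨h0, h1⟩) hM).le
  have hconc : ConcaveOn ℝ (Icc 0 1) u := by
    refine concaveOn_of_hasDerivWithinAt2_nonpos (convex_Icc 0 1) hsol.continuousOn
      (fun x hx => (hsol.hasDeriv x (interior_subset hx)).mono interior_subset)
      (fun x hx => (hsol.hasDeriv₂ x (interior_subset hx)).mono interior_subset) fun x hx => ?_
    have hx' := interior_subset hx
    exact mul_nonpos_of_nonpos_of_nonneg (by linarith [(hq hx').2, hμ.1]) (hnn x hx')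
  refine ⟨μ, u, u₁, hsol, hu0, hu1, hμ, hle, fun x hx => ?_, fun x hx => ?_⟩
  · rcases le_total x m with hxm | hxm
    · have := hconc.2 (left_mem_Icc.2 zero_le_one) hm
        (show 0 ≤ 1 - x / m from sub_nonneg.2 ((div_le_one hm0).2 hxm))
        (show 0 ≤ x / m from div_nonneg hx.1 hm0.le) (by ring)
      simp only [smul_eq_mul, hu0, hum, mul_zero, zero_add, mul_one, div_mul_cancel₀ _ hm0.ne']
        at this
      have h2 : x ≤ x / m := le_div_self hx.1 hm0 hm.2
      nlinarith [hx.1]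
    · have hd : 0 < 1 - m := sub_pos.2 hm1
      have := hconc.2 (right_mem_Icc.2 zero_le_one) hm
        (show 0 ≤ 1 - (1 - x) / (1 - m) from sub_nonneg.2 ((div_le_one hd).2 (by linarith)))
        (show 0 ≤ (1 - x) / (1 - m) from div_nonneg (sub_nonneg.2 hx.2) hd.le) (by ring)
      have e : (1 - (1 - x) / (1 - m)) * 1 + (1 - x) / (1 - m) * m = x := by
        field_simp; ring
      simp only [smul_eq_mul, hu1, hum, mul_zero, zero_add] at this
      rw [e] at this
      have h2 : 1 - x ≤ (1 - x) / (1 - m) := le_div_self (sub_nonneg.2 hx.2) hd (by linarith)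
      nlinarith [hx.1, hx.2]
  · have hext : u₁ m = 0 := by
      have hd : HasDerivAt u (u₁ m) m := (hsol.hasDeriv m hm).hasDerivAt (Icc_mem_nhds hm0 hm1)
      refine IsLocalMax.hasDerivAt_eq_zero ?_ hd
      filter_upwards [Icc_mem_nhds hm0 hm1] with y hy
      rw [hum]; exact hle y hy
    have := abs_sub_le_of_hasDerivWithinAt (C := 11) hsol.hasDeriv₂ (fun y hy => ?_) hm hx
    · rw [hext, sub_zero] at this
      refine this.trans ?_
      have : |x - m| ≤ 1 := abs_le.2 ⟨by linarith [hx.1, hm.2], by linarith [hx.2, hm.1]⟩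
      linarith
    · rw [abs_mul]
      have h1 := hq hy
      have h2 : |q y - μ| ≤ 11 := abs_le.2 ⟨by linarith [h1.1, hμ.2], by linarith [h1.2, hμ.1]⟩
      have h3 : |u y| ≤ 1 := abs_le.2 ⟨by linarith [hnn y hy], hle y hy⟩
      nlinarith [abs_nonneg (q y - μ), abs_nonneg (u y)]

/-- The Lipschitz bounds from the two ends give L min(x, 1 - x), and max(x, 1 - x) ≥ 1/2. This
controls v²/u near the endpoints, where u ≥ x(1 - x). -/
lemma abs_le_mul_mul_one_sub {v v₁ : ℝ → ℝ} {L : ℝ}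
    (hv : ∀ x ∈ Icc (0 : ℝ) 1, HasDerivWithinAt v (v₁ x) (Icc 0 1) x)
    (hL : ∀ x ∈ Icc (0 : ℝ) 1, |v₁ x| ≤ L) (h0 : v 0 = 0) (h1 : v 1 = 0)
    {x : ℝ} (hx : x ∈ Icc (0 : ℝ) 1) : |v x| ≤ 2 * L * (x * (1 - x)) := by
  have hL0 : 0 ≤ L := (abs_nonneg _).trans (hL x hx)
  have a := abs_sub_le_of_hasDerivWithinAt hv hL (left_mem_Icc.2 zero_le_one) hx
  have b := abs_sub_le_of_hasDerivWithinAt hv hL (right_mem_Icc.2 zero_le_one) hx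
  rw [h0, sub_zero, sub_zero, abs_of_nonneg hx.1] at a
  rw [h1, sub_zero, abs_sub_comm, abs_of_nonneg (sub_nonneg.2 hx.2)] at b
  rcases le_total x (1 / 2) with h | h
  · nlinarith [mul_nonneg hL0 hx.1]
  · nlinarith [mul_nonneg hL0 (sub_nonneg.2 hx.2)]

lemma ContinuousOn.exists_abs_le {f : ℝ → ℝ} (hf : ContinuousOn f (Icc (0 : ℝ) 1)) :
    ∃ L, ∀ x ∈ Icc (0 : ℝ) 1, |f x| ≤ L := by
  obtain ⟨L, hL⟩ := isCompact_Icc.exists_bound_of_continuousOn hf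
  exact ⟨L, hL⟩

/-- The variational inequality for the ground state energy, by the Picone identity. -/
lemma IsGroundState.integral_nonneg (h : IsGroundState q μ u u₁) (hq : ContinuousOn q (Icc 0 1))
    {v v₁ : ℝ → ℝ} (hv : ∀ x ∈ Icc (0 : ℝ) 1, HasDerivWithinAt v (v₁ x) (Icc 0 1) x)
    (hv₁ : ContinuousOn v₁ (Icc 0 1)) (h0 : v 0 = 0) (h1 : v 1 = 0) :
    0 ≤ ∫ x in (0 : ℝ)..1, (v₁ x ^ 2 + (q x - μ) * v x ^ 2) := by
  obtain ⟨L, hL⟩ := ContinuousOn.exists_abs_le hv₁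
  have hvc : ContinuousOn v (Icc 0 1) := fun x hx => (hv x hx).continuousWithinAt
  -- Picone: Φ' is the integrand minus the square (v' - v u'/u)². At the endpoints the division
  -- convention sets Φ to 0, and the bound below shows that this value is the continuous one.
  set Φ : ℝ → ℝ := fun x => v x ^ 2 / u x * u₁ x with hΦ
  have hΦle : ∀ x ∈ Icc (0 : ℝ) 1, |Φ x| ≤ 44 * L ^ 2 * (x * (1 - x)) := fun x hx => by
    have hw : 0 ≤ x * (1 - x) := mul_nonneg hx.1 (sub_nonneg.2 hx.2)
    have hr : |v x ^ 2 / u x| ≤ 4 * L ^ 2 * (x * (1 - x)) := by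
      have hvx := abs_le_mul_mul_one_sub hv hL h0 h1 hx
      have hsq : v x ^ 2 ≤ (2 * L * (x * (1 - x))) ^ 2 := sq_le_sq' (by
        linarith [neg_abs_le (v x)]) ((le_abs_self _).trans hvx)
      rw [abs_of_nonneg (div_nonneg (sq_nonneg _) (h.nonneg hx))]
      refine div_le_of_le_mul₀ (h.nonneg hx) (by positivity) (hsq.trans ?_)
      have := mul_le_mul_of_nonneg_left (h.le_self x hx)
        (by positivity : 0 ≤ 4 * L ^ 2 * (x * (1 - x)))
      linarith
    rw [hΦ, abs_mul]
    calc |v x ^ 2 / u x| * |u₁ x| ≤ 4 * L ^ 2 * (x * (1 - x)) * 11 := by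
          gcongr
          exact h.abs_deriv_le x hx
      _ = _ := by ring
  have hΦend : ∀ x ∈ Icc (0 : ℝ) 1, x * (1 - x) = 0 →
      ContinuousWithinAt Φ (Icc 0 1) x ∧ Φ x = 0 := by
    intro x hx hx0
    have hz : Φ x = 0 := by simpa [hx0] using hΦle x hx
    refine ⟨?_, hz⟩
    rw [ContinuousWithinAt, hz]
    refine squeeze_zero_norm' (eventually_nhdsWithin_of_forall hΦle) ?_
    have : Continuous fun x : ℝ => 44 * L ^ 2 * (x * (1 - x)) := by fun_prop
    have h2 := (this.tendsto x).mono_left (nhdsWithin_le_nhds (s := Icc 0 1))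
    simpa [hx0] using h2
  have hderiv : ∀ x ∈ Ioo (0 : ℝ) 1, HasDerivAt Φ
      (v₁ x ^ 2 + (q x - μ) * v x ^ 2 - (v₁ x - v x * u₁ x / u x) ^ 2) x := fun x hx => by
    have hx' : x ∈ Icc (0 : ℝ) 1 := ⟨hx.1.le, hx.2.le⟩
    have hn := Icc_mem_nhds hx.1 hx.2
    have hux := (h.pos hx).ne'
    refine (((((hv x hx').hasDerivAt hn).pow 2).div ((h.hasDeriv x hx').hasDerivAt hn) hux).mul
      ((h.hasDeriv₂ x hx').hasDerivAt hn)).congr_deriv ?_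
    simp only [Pi.pow_apply, Pi.div_apply, Nat.cast_ofNat]
    field_simp
    ring
  have hcont : ContinuousOn Φ (Icc 0 1) := fun x hx => by
    by_cases hx0 : x * (1 - x) = 0
    · exact (hΦend x hx hx0).1
    · have : x ∈ Ioo (0 : ℝ) 1 := by
        refine ⟨hx.1.lt_of_ne ?_, hx.2.lt_of_ne ?_⟩ <;> rintro rfl <;> simp at hx0
      exact (hderiv x this).continuousAt.continuousWithinAt
  have hint : ContinuousOn (fun x => v₁ x ^ 2 + (q x - μ) * v x ^ 2) (Icc 0 1) := by fun_prop
  -- The inequality form of the fundamental theorem needs no integrability of the discarded square.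
  have := intervalIntegral.sub_le_integral_of_hasDeriv_right_of_le zero_le_one hcont
    (fun x hx => (hderiv x hx).hasDerivWithinAt) hint.integrableOn_Icc
    (fun x _ => sub_le_self _ (sq_nonneg _))
  rwa [(hΦend 1 (by simp) (by simp)).2, (hΦend 0 (by simp) (by simp)).2, sub_zero] at this

/-- The energy identity for an eigenfunction. -/
lemma IsSolution.integral_eq_zero {v v₁ : ℝ → ℝ} (h : IsSolution q μ v v₁)
    (hq : ContinuousOn q (Icc 0 1)) (h0 : v 0 = 0) (h1 : v 1 = 0) :
    ∫ x in (0 : ℝ)..1, (v₁ x ^ 2 + (q x - μ) * v x ^ 2) = 0 := by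
  have hc := h.continuousOn
  have hc₁ := h.continuousOn₁
  have := intervalIntegral.integral_eq_sub_of_hasDerivAt_of_le zero_le_one (hc.mul hc₁)
    (f' := fun x => v₁ x ^ 2 + (q x - μ) * v x ^ 2) (fun x hx => ?_)
    (ContinuousOn.intervalIntegrable (by rw [uIcc_of_le zero_le_one]; fun_prop))
  · simpa [h0, h1] using this
  · have hx' : x ∈ Icc (0 : ℝ) 1 := ⟨hx.1.le, hx.2.le⟩
    have hn := Icc_mem_nhds hx.1 hx.2
    exact (((h.hasDeriv x hx').hasDerivAt hn).mul
      ((h.hasDeriv₂ x hx').hasDerivAt hn)).congr_deriv (by ring)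

lemma integral_sq_pos {v : ℝ → ℝ} (hv : ContinuousOn v (Icc 0 1))
    (hne : ∃ x ∈ Icc (0 : ℝ) 1, v x ≠ 0) : 0 < ∫ x in (0 : ℝ)..1, v x ^ 2 := by
  obtain ⟨x, hx, hne⟩ := hne
  exact intervalIntegral.integral_pos zero_lt_one (hv.pow 2) (fun _ _ => sq_nonneg _)
    ⟨x, hx, by positivity⟩

/-- For another eigenpair (ν, v) the energy of v at level ν is 0 and at level μ is nonnegative;
their difference is (ν - μ)∫v². -/
lemma IsGroundState.isLeast (h : IsGroundState q μ u u₁) (hq : ContinuousOn q (Icc 0 1)) :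
    IsLeast (eigenvalues q) μ := by
  refine ⟨⟨u, h.toIsSolution.isEigenfunction hq h.left h.right
    ⟨1 / 2, by norm_num, (h.pos (by norm_num)).ne'⟩⟩, ?_⟩
  rintro ν ⟨v, hv⟩
  have hs := hv.isSolution hq
  set v₁ := iteratedDerivWithin 1 v (Icc 0 1)
  have hc := hs.continuousOn
  have hc₁ := hs.continuousOn₁
  have a := h.integral_nonneg hq hs.hasDeriv hc₁ hv.left hv.right
  have b := hs.integral_eq_zero hq hv.left hv.right
  have hp := integral_sq_pos hc hv.nonzero
  have hadd : ∫ x in (0 : ℝ)..1, (v₁ x ^ 2 + (q x - μ) * v x ^ 2)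
      = (∫ x in (0 : ℝ)..1, (v₁ x ^ 2 + (q x - ν) * v x ^ 2))
        + (ν - μ) * ∫ x in (0 : ℝ)..1, v x ^ 2 := by
    rw [← intervalIntegral.integral_const_mul, ← intervalIntegral.integral_add]
    · congr 1; ext x; ring
    all_goals exact ContinuousOn.intervalIntegrable (by rw [uIcc_of_le zero_le_one]; fun_prop)
  rw [b, zero_add] at hadd
  rw [hadd] at a
  by_contra! hlt
  nlinarith

lemma IsGroundState.smallestEigenvalue_eq (h : IsGroundState q μ u u₁)
    (hq : ContinuousOn q (Icc 0 1)) : smallestEigenvalue q = μ := (h.isLeast hq).csInf_eq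

lemma potentials.continuousOn (hq : q ∈ potentials) : ContinuousOn q (Icc 0 1) := hq.1.continuousOn

lemma exists_isGroundState_smallestEigenvalue (hq : q ∈ potentials) :
    ∃ u u₁, IsGroundState q (smallestEigenvalue q) u u₁ := by
  obtain ⟨μ, u, u₁, h⟩ := exists_isGroundState (potentials.continuousOn hq) hq.2.1
  rw [h.smallestEigenvalue_eq (potentials.continuousOn hq)]
  exact ⟨u, u₁, h⟩

lemma isLeast_smallestEigenvalue (hq : q ∈ potentials) :
    IsLeast (eigenvalues q) (smallestEigenvalue q) := by
  obtain ⟨u, u₁, h⟩ := exists_isGroundState_smallestEigenvalue hq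
  exact h.isLeast (potentials.continuousOn hq)

end

/-! ### The finite difference matrix -/

/-- Row `i` of the finite difference operator applied to grid values `W 0, …, W (n + 1)`. -/
def fdRow (n : ℕ) (q : ℝ → ℝ) (W : ℕ → ℝ) (i : ℕ) : ℝ :=
  (2 * ((n : ℝ) + 1) ^ 2 + q (((i : ℝ) + 1) / ((n : ℝ) + 1))) * W (i + 1)
    - ((n : ℝ) + 1) ^ 2 * (W i + W (i + 2))

section

open Matrix

variable {n : ℕ} {q : ℝ → ℝ}

/-- The boundary zeros of `W` supply the neighbours missing in the first and last rows. Row `i`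
belongs to the grid point of index `i + 1`. -/
lemma fdMatrix_mulVec {W : ℕ → ℝ} (h0 : W 0 = 0) (h1 : W (n + 1) = 0) (i : Fin n) :
    (fdMatrix n q *ᵥ fun j : Fin n => W (j + 1)) i = fdRow n q W i := by
  have hterm : ∀ j : Fin n, fdMatrix n q i j * W (j + 1) =
      ((if (j : ℕ) = i then
          (2 * ((n : ℝ) + 1) ^ 2 + q (((i : ℕ) + 1 : ℝ) / ((n : ℝ) + 1))) * W (j + 1) else 0)
        - (if (j : ℕ) + 1 = i then ((n : ℝ) + 1) ^ 2 * W (j + 1) else 0))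
        - (if (j : ℕ) = i + 1 then ((n : ℝ) + 1) ^ 2 * W (j + 1) else 0) := by
    intro j
    simp only [fdMatrix, Fin.ext_iff]
    split_ifs <;> first | omega | ring
  simp only [mulVec, dotProduct]
  rw [Finset.sum_congr rfl fun j _ => hterm j, Finset.sum_sub_distrib, Finset.sum_sub_distrib,
    Fin.sum_univ_eq_sum_range (fun j => if j = (i : ℕ) then
      (2 * ((n : ℝ) + 1) ^ 2 + q (((i : ℕ) + 1 : ℝ) / ((n : ℝ) + 1))) * W (j + 1) else 0),
    Fin.sum_univ_eq_sum_range (fun j => if j + 1 = (i : ℕ) then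
      ((n : ℝ) + 1) ^ 2 * W (j + 1) else 0),
    Fin.sum_univ_eq_sum_range (fun j => if j = (i : ℕ) + 1 then
      ((n : ℝ) + 1) ^ 2 * W (j + 1) else 0)]
  obtain ⟨i, hi⟩ := i
  simp only [fdRow]
  have e2 : ∑ j ∈ Finset.range n, (if j + 1 = i then ((n : ℝ) + 1) ^ 2 * W (j + 1) else 0)
      = ((n : ℝ) + 1) ^ 2 * W i := by
    cases i with
    | zero => simp [h0]
    | succ k =>
      simp only [Nat.add_right_cancel_iff]
      rw [Finset.sum_ite_eq', if_pos (Finset.mem_range.2 (by omega))]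
  have e3 : ∑ j ∈ Finset.range n, (if j = i + 1 then ((n : ℝ) + 1) ^ 2 * W (j + 1) else 0)
      = ((n : ℝ) + 1) ^ 2 * W (i + 2) := by
    rw [Finset.sum_ite_eq']
    split_ifs with h
    · rfl
    · have : i + 2 = n + 1 := by rw [Finset.mem_range] at h; omega
      rw [this, h1, mul_zero]
  rw [e2, e3, Finset.sum_ite_eq', if_pos (Finset.mem_range.2 hi)]
  ring

lemma isHermitian_fdMatrix : (fdMatrix n q).IsHermitian := by
  ext i j
  simp only [conjTranspose_apply, fdMatrix, star_trivial]
  by_cases h : i = j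
  · simp [h]
  · simp [h, Ne.symm h, or_comm]

lemma bddBelow_spectrum_fdMatrix : BddBelow (spectrum ℝ (fdMatrix n q)) :=
  (finite_real_spectrum (A := fdMatrix n q)).bddBelow

lemma nonempty_spectrum_fdMatrix (hn : 1 ≤ n) : (spectrum ℝ (fdMatrix n q)).Nonempty := by
  rw [(isHermitian_fdMatrix (n := n) (q := q)).spectrum_real_eq_range_eigenvalues]
  exact ⟨_, ⟨⟨0, hn⟩, rfl⟩⟩

lemma exists_eigenvector_of_mem_spectrum {μ : ℝ} (h : μ ∈ spectrum ℝ (fdMatrix n q)) :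
    ∃ z : Fin n → ℝ, z ≠ 0 ∧ fdMatrix n q *ᵥ z = μ • z := by
  rw [(isHermitian_fdMatrix (n := n) (q := q)).spectrum_real_eq_range_eigenvalues] at h
  obtain ⟨i, rfl⟩ := h
  refine ⟨_, ?_, isHermitian_fdMatrix.mulVec_eigenvectorBasis i⟩
  intro h0
  have := (isHermitian_fdMatrix (n := n) (q := q)).eigenvectorBasis.orthonormal.ne_zero i
  exact this (by ext j; exact congrFun h0 j)

/-- A positive supersolution bounds the smallest eigenvalue from below. -/
lemma le_fdEigenvalue {x : ℝ} (hn : 1 ≤ n) {W : ℕ → ℝ} (h0 : W 0 = 0) (h1 : W (n + 1) = 0)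
    (hpos : ∀ i < n, 0 < W (i + 1)) (h : ∀ i < n, x * W (i + 1) ≤ fdRow n q W i) :
    x ≤ fdEigenvalue n q := by
  refine le_csInf (nonempty_spectrum_fdMatrix hn) fun μ hμ => ?_
  obtain ⟨z, hz, hMz⟩ := exists_eigenvector_of_mem_spectrum hμ
  have : Nonempty (Fin n) := ⟨⟨0, hn⟩⟩
  -- Let t be the maximal ratio |z|/W. Then z ≤ tW with equality at i, up to the sign of z. As the
  -- off-diagonal entries are negative, (Mz)ᵢ ≥ t(MW)ᵢ ≥ x t Wᵢ = x zᵢ.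
  obtain ⟨i, hi⟩ := Finite.exists_max fun j : Fin n => |z j| / W (j + 1)
  wlog hzi : 0 ≤ z i generalizing z
  · refine this (-z) (neg_ne_zero.2 hz) (by rw [mulVec_neg, hMz, smul_neg]) (by simpa using hi) ?_
    simp only [Pi.neg_apply]; linarith
  set t := |z i| / W (i + 1) with ht
  have hWi := hpos i i.2
  have hzt : ∀ j : Fin n, |z j| ≤ t * W (j + 1) := fun j => (div_le_iff₀ (hpos j j.2)).1 (hi j)
  have hzi' : z i = t * W (i + 1) := by
    rw [ht, abs_of_nonneg hzi, div_mul_cancel₀ _ hWi.ne']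
  have ht0 : 0 < t := by
    obtain ⟨j, hj⟩ := Function.ne_iff.1 hz
    exact (div_pos (abs_pos.2 hj) (hpos j j.2)).trans_le (hi j)
  set Z : ℕ → ℝ := fun m => if hm : 1 ≤ m ∧ m ≤ n then z ⟨m - 1, by omega⟩ else 0 with hZ
  have hZz : ∀ j : Fin n, Z (j + 1) = z j := fun j => by
    simp only [hZ]
    rw [dif_pos ⟨by omega, by omega⟩]
    congr
  have hZle : ∀ m ≤ n + 1, Z m ≤ t * W m := fun m hm => by
    rcases Nat.eq_zero_or_pos m with rfl | hm0
    · simp [hZ, h0]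
    · rcases Nat.lt_or_ge n m with hm1 | hm1
      · have : m = n + 1 := by omega
        subst this
        simp [hZ, h1]
      · obtain ⟨k, rfl⟩ : ∃ k, m = k + 1 := ⟨m - 1, by omega⟩
        have := hZz ⟨k, by omega⟩
        simp only at this
        rw [this]
        exact (le_abs_self _).trans (hzt ⟨k, by omega⟩)
  have hrow := fdMatrix_mulVec (q := q) (W := Z) (n := n) (by simp [hZ]) (by simp [hZ]) i
  simp only [hZz] at hrow
  rw [hMz, Pi.smul_apply, smul_eq_mul] at hrow
  have hx := h i i.2
  have a1 := hZle i (by omega)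
  have a2 := hZle (i + 2) (by omega)
  simp only [fdRow, hZz] at hrow hx
  have hxz : x * z i ≤ μ * z i := by
    rw [hrow, hzi']
    have := mul_le_mul_of_nonneg_left hx ht0.le
    have h3 := mul_le_mul_of_nonneg_left (add_le_add a1 a2) (sq_nonneg ((n : ℝ) + 1))
    nlinarith
  exact le_of_mul_le_mul_right hxz (by rw [hzi']; positivity)

lemma posDef_sub_of_lt_fdEigenvalue {x : ℝ} (hx : x < fdEigenvalue n q) :
    (fdMatrix n q - algebraMap ℝ _ x).PosDef := by
  have hH : (fdMatrix n q - algebraMap ℝ (Matrix (Fin n) (Fin n) ℝ) x).IsHermitian := by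
    refine isHermitian_fdMatrix.sub ?_
    rw [algebraMap_eq_diagonal]
    exact isHermitian_diagonal _
  refine hH.posDef_iff_eigenvalues_pos.2 fun i => ?_
  have hi := hH.eigenvalues_mem_spectrum_real i
  rw [← spectrum.sub_singleton_eq] at hi
  obtain ⟨y, hy, z, hz, hyz⟩ := Set.mem_sub.1 hi
  rw [Set.mem_singleton_iff.1 hz] at hyz
  have : fdEigenvalue n q ≤ y := csInf_le bddBelow_spectrum_fdMatrix hy
  linarith

/-- The Rayleigh principle, in a form with a pointwise hypothesis. -/
lemma fdEigenvalue_le {x : ℝ} {W : ℕ → ℝ} (h0 : W 0 = 0) (h1 : W (n + 1) = 0)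
    (hne : ∃ i < n, W (i + 1) ≠ 0)
    (h : ∀ i < n, W (i + 1) * fdRow n q W i ≤ W (i + 1) * (x * W (i + 1))) :
    fdEigenvalue n q ≤ x := by
  by_contra! hlt
  have hP := posDef_sub_of_lt_fdEigenvalue hlt
  obtain ⟨i, hi, hWi⟩ := hne
  have := hP.dotProduct_mulVec_pos (x := fun j : Fin n => W (j + 1))
    (Function.ne_iff.2 ⟨⟨i, hi⟩, hWi⟩)
  rw [star_trivial, sub_mulVec, algebraMap_eq_diagonal] at this
  refine this.not_ge (Finset.sum_nonpos fun j _ => ?_)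
  rw [Pi.sub_apply, fdMatrix_mulVec h0 h1, mulVec_diagonal, mul_sub]
  simpa using h j j.2

lemma fdRow_eq (W : ℕ → ℝ) (i : ℕ) : fdRow n q W i =
    ((n : ℝ) + 1) ^ 2 * (2 * W (i + 1) - W i - W (i + 2))
      + q (((i : ℝ) + 1) / ((n : ℝ) + 1)) * W (i + 1) := by
  simp only [fdRow]; ring

lemma node_mem_Icc {i : ℕ} (hi : i < n) : ((i : ℝ) + 1) / ((n : ℝ) + 1) ∈ Icc (0 : ℝ) 1 := by
  have : (i : ℝ) < n := by exact_mod_cast hi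
  exact ⟨by positivity, (div_le_one (by positivity)).2 (by linarith)⟩

/-- The discrete parabola m(n + 1 - m) is positive with negated second difference 2, hence a
supersolution for x = 0. -/
lemma fdEigenvalue_nonneg (hn : 1 ≤ n) (hq : MapsTo q (Icc 0 1) (Icc 0 1)) :
    0 ≤ fdEigenvalue n q := by
  have hpos : ∀ i < n, (0 : ℝ) < ((i + 1 : ℕ) : ℝ) * ((n : ℝ) + 1 - ((i + 1 : ℕ) : ℝ)) := by
    intro i hi
    have : (i : ℝ) + 1 ≤ n := by exact_mod_cast hi
    push_cast
    exact mul_pos (by positivity) (by linarith)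
  refine le_fdEigenvalue hn (W := fun m => (m : ℝ) * ((n : ℝ) + 1 - m)) (by simp) (by simp) hpos
    fun i hi => ?_
  rw [fdRow_eq, zero_mul]
  have h1 := hpos i hi
  have h2 := (hq (node_mem_Icc hi)).1
  refine add_nonneg (mul_nonneg (by positivity) ?_) (mul_nonneg h2 h1.le)
  push_cast
  nlinarith

/-- Test with the discrete sine, the first eigenvector for q = 0: its eigenvalue 2(n + 1)²(1 - cos
δ) is at most π² < 10, and q adds at most 1. -/
lemma fdEigenvalue_le_eleven (hn : 1 ≤ n) (hq : MapsTo q (Icc 0 1) (Icc 0 1)) :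
    fdEigenvalue n q ≤ 11 := by
  have hN : (0 : ℝ) < (n : ℝ) + 1 := by positivity
  set δ := Real.pi / ((n : ℝ) + 1) with hδ
  have hδN : δ * ((n : ℝ) + 1) = Real.pi := div_mul_cancel₀ _ hN.ne'
  have hδ0 : 0 < δ := div_pos Real.pi_pos hN
  have hpos : ∀ i < n, (0 : ℝ) < Real.sin (δ * ((i + 1 : ℕ) : ℝ)) := by
    intro i hi
    have : (i : ℝ) + 1 ≤ n := by exact_mod_cast hi
    refine Real.sin_pos_of_pos_of_lt_pi (by positivity) ?_
    rw [← hδN]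
    push_cast
    exact mul_lt_mul_of_pos_left (by linarith) hδ0
  refine fdEigenvalue_le (W := fun m => Real.sin (δ * m)) (by simp) ?_
    ⟨0, hn, (hpos 0 hn).ne'⟩ fun i hi => ?_
  · push_cast; rw [hδN, Real.sin_pi]
  have hp := hpos i hi
  refine mul_le_mul_of_nonneg_left ?_ hp.le
  rw [fdRow_eq]
  have e : 2 * Real.sin (δ * ((i + 1 : ℕ) : ℝ)) - Real.sin (δ * (i : ℝ))
      - Real.sin (δ * ((i + 2 : ℕ) : ℝ))
      = 2 * (1 - Real.cos δ) * Real.sin (δ * ((i + 1 : ℕ) : ℝ)) := by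
    have a : δ * (i : ℝ) = δ * ((i + 1 : ℕ) : ℝ) - δ := by push_cast; ring
    have b : δ * ((i + 2 : ℕ) : ℝ) = δ * ((i + 1 : ℕ) : ℝ) + δ := by push_cast; ring
    rw [a, b, Real.sin_sub, Real.sin_add]; ring
  rw [e]
  have hc := Real.one_sub_sq_div_two_le_cos (x := δ)
  have h1 := (hq (node_mem_Icc hi)).2
  have h2 : ((n : ℝ) + 1) ^ 2 * (2 * (1 - Real.cos δ)) ≤ Real.pi ^ 2 := by
    rw [← hδN, mul_pow, mul_comm]
    gcongr
    linarith
  have h3 := pi_sq_lt_ten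
  nlinarith

/-! ### Sturm sequences -/

/-- The Sturm sequence, scaled so as to satisfy the equations `(M_q - x) V = 0`. -/
def sturmVec (n : ℕ) (q : ℝ → ℝ) (x : ℝ) : ℕ → ℝ
  | 0 => 0
  | k + 1 => sturmSeq n q x k / (((n : ℝ) + 1) ^ 2) ^ k

lemma fdRow_sturmVec (x : ℝ) (i : ℕ) :
    fdRow n q (sturmVec n q x) i = x * sturmVec n q x (i + 1) := by
  have hN : ((n : ℝ) + 1) ≠ 0 := by positivity
  cases i with
  | zero =>
    simp only [fdRow, sturmVec, sturmSeq]
    field_simp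
    simp
  | succ k =>
    simp only [fdRow, sturmVec, sturmSeq]
    push_cast
    rw [show (k : ℝ) + 1 + 1 = k + 2 by ring]
    field_simp
    ring

lemma sturmVec_pos_iff {x : ℝ} (k : ℕ) : 0 < sturmVec n q x (k + 1) ↔ 0 < sturmSeq n q x k := by
  simp only [sturmVec]
  exact div_pos_iff_of_pos_right (by positivity)

lemma continuous_sturmSeq (j : ℕ) : Continuous fun x => sturmSeq n q x j := by
  induction j using Nat.twoStepInduction with
  | zero => simp only [sturmSeq]; fun_prop
  | one => simp only [sturmSeq]; fun_prop
  | more k h1 h2 => simp only [sturmSeq]; fun_prop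

/-- The scaled Sturm vector solves every row but has a positive value at the boundary index n + 1.
Replacing that value by 0 only increases the last row, which leaves a positive supersolution. -/
lemma le_fdEigenvalue_of_sturmSeq_pos {x : ℝ} (hn : 1 ≤ n)
    (h : ∀ j ≤ n, 0 < sturmSeq n q x j) : x ≤ fdEigenvalue n q := by
  set V := sturmVec n q x with hV
  have hVpos : ∀ i ≤ n, 0 < V (i + 1) := fun i hi => (sturmVec_pos_iff i).2 (h i hi)
  refine le_fdEigenvalue hn (W := fun m => if m ≤ n then V m else 0) ?_ (by simp)
    (fun i hi => ?_) fun i hi => ?_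
  · simp [hV, sturmVec]
  · rw [if_pos (by omega)]; exact hVpos i hi.le
  · have hr := fdRow_sturmVec (n := n) (q := q) x i
    simp only [fdRow] at hr ⊢
    rw [if_pos (by omega), if_pos (by omega), ← hr]
    have : (if i + 2 ≤ n then V (i + 2) else 0) ≤ V (i + 2) := by
      split_ifs
      · exact le_rfl
      · exact (hVpos (i + 1) (by omega)).le
    gcongr

lemma sturmSeq_pos_iff_lt_fdEigenvalue {x : ℝ} (hn : 1 ≤ n) :
    (∀ j ≤ n, 0 < sturmSeq n q x j) ↔ x < fdEigenvalue n q := by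
  constructor
  · intro h
    -- Positivity persists for some y > x, which makes the inequality strict.
    have hev : ∀ᶠ y in 𝓝 x, ∀ j ∈ Iic n, 0 < sturmSeq n q y j :=
      (eventually_all_finite (finite_Iic n)).2 fun j hj =>
        (continuous_sturmSeq j).continuousAt.eventually (lt_mem_nhds (h j hj))
    obtain ⟨y, hxy, hy⟩ := ((frequently_gt_nhds x).and_eventually hev).exists
    exact lt_of_lt_of_le hxy (le_fdEigenvalue_of_sturmSeq_pos hn hy)
  · intro hx
    by_contra! hneg
    classical
    obtain ⟨hjn, hj⟩ := Nat.find_spec hneg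
    set j := Nat.find hneg with hjdef
    have hmin : ∀ m < j, 0 < sturmSeq n q x m := fun m hm => by
      by_contra! hle
      exact Nat.find_min hneg hm ⟨by omega, hle⟩
    set V := sturmVec n q x with hV
    have hj0 : j ≠ 0 := by
      intro h0
      rw [h0] at hj
      simp only [sturmSeq] at hj
      linarith
    -- Cut the vector off just before the first nonpositive term, which sits at index j + 1.
    -- Replacing it by 0 only lowers row j - 1, and beyond the cut the test vector vanishes, so its
    -- Rayleigh quotient is at most x.
    refine hx.not_ge (fdEigenvalue_le (W := fun m => if m ≤ j then V m else 0) ?_ ?_ ?_ ?_)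
    · simp [hV, sturmVec]
    · rw [if_neg (by omega)]
    · refine ⟨0, hn, ?_⟩
      rw [if_pos (by omega)]
      exact ((sturmVec_pos_iff 0).2 (hmin 0 (by omega))).ne'
    · intro i hi
      rcases Nat.lt_or_ge i j with hij | hij
      · have hp : 0 < V (i + 1) := (sturmVec_pos_iff i).2 (hmin i hij)
        have hr := fdRow_sturmVec (n := n) (q := q) x i
        simp only [fdRow] at hr ⊢
        rw [if_pos (show i + 1 ≤ j by omega), if_pos (show i ≤ j by omega), ← hr]
        have : V (i + 2) ≤ if i + 2 ≤ j then V (i + 2) else 0 := by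
          split_ifs with hc
          · exact le_rfl
          · have hij' : i + 1 = j := by omega
            have : ¬ 0 < V (i + 1 + 1) := by
              rw [hV, sturmVec_pos_iff, hij']; exact hj.not_gt
            exact not_lt.1 this
        gcongr
      · simp [show ¬ i + 1 ≤ j by omega]

/-! ### Bisection -/

lemma bisectionInterval_spec (hn : 1 ≤ n) (hq : MapsTo q (Icc 0 1) (Icc 0 1)) (k : ℕ) :
    (bisectionInterval n q k).1 ≤ fdEigenvalue n q ∧
      fdEigenvalue n q ≤ (bisectionInterval n q k).2 ∧
      (bisectionInterval n q k).2 - (bisectionInterval n q k).1 = 11 / 2 ^ k := by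
  induction k with
  | zero =>
    exact ⟨fdEigenvalue_nonneg hn hq, fdEigenvalue_le_eleven hn hq, by simp [bisectionInterval]⟩
  | succ k ih =>
    obtain ⟨h1, h2, h3⟩ := ih
    simp only [bisectionInterval, sturmSeq_pos_iff_lt_fdEigenvalue hn]
    have e : (11 : ℝ) / 2 ^ (k + 1) = (11 / 2 ^ k) / 2 := by rw [pow_succ]; field_simp
    split_ifs with h
    · exact ⟨h.le, h2, by simp only; rw [e, ← h3]; ring⟩
    · exact ⟨h1, not_lt.1 h, by simp only; rw [e, ← h3]; ring⟩

lemma abs_fdEigenvalue_sub_sturmBisection_le (hn : 1 ≤ n) (hq : MapsTo q (Icc 0 1) (Icc 0 1))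
    (k : ℕ) : |fdEigenvalue n q - sturmBisection n k q| ≤ 11 / 2 ^ (k + 1) := by
  obtain ⟨h1, h2, h3⟩ := bisectionInterval_spec hn hq k
  have e : (11 : ℝ) / 2 ^ (k + 1) = (11 / 2 ^ k) / 2 := by rw [pow_succ]; field_simp
  rw [e, ← h3, sturmBisection, abs_le]
  constructor <;> linarith

end

/-! ### Accuracy of the finite difference eigenvalue -/

lemma abs_le_of_abs_deriv_le {F F' B B' : ℝ → ℝ} {t : ℝ} (ht : 0 ≤ t)
    (hc : ContinuousOn F (Icc 0 t)) (hF : ∀ s ∈ Ico 0 t, HasDerivAt F (F' s) s)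
    (hB : ∀ s, HasDerivAt B (B' s) s) (h0 : F 0 = 0) (hB0 : B 0 = 0)
    (h : ∀ s ∈ Ico 0 t, |F' s| ≤ B' s) : |F t| ≤ B t :=
  image_norm_le_of_norm_deriv_right_le_deriv_boundary hc
    (fun s hs => (hF s hs).hasDerivWithinAt) (by simp [h0, hB0]) hB h ⟨ht, le_rfl⟩

/-! ### Taylor estimates for symmetric second differences -/

section

variable {f f₁ f₂ : ℝ → ℝ} {x t G : ℝ}

lemma hasDerivAt_add_sub
    (h₁ : ∀ y ∈ Icc (0 : ℝ) 1, HasDerivWithinAt f (f₁ y) (Icc 0 1) y)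
    (hl : 0 ≤ x - t) (hr : x + t ≤ 1) {s : ℝ} (hs : s ∈ Ico 0 t) :
    HasDerivAt (fun s => f (x + s)) (f₁ (x + s)) s ∧
      HasDerivAt (fun s => f (x - s)) (-f₁ (x - s)) s := by
  obtain ⟨hs0, hst⟩ := hs
  constructor
  · have : x + s ∈ Ioo (0 : ℝ) 1 := ⟨by linarith, by linarith⟩
    exact ((h₁ _ ⟨this.1.le, this.2.le⟩).hasDerivAt (Icc_mem_nhds this.1 this.2)).comp_const_add x s
  · have : x - s ∈ Ioo (0 : ℝ) 1 := ⟨by linarith, by linarith⟩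
    exact ((h₁ _ ⟨this.1.le, this.2.le⟩).hasDerivAt (Icc_mem_nhds this.1 this.2)).comp_const_sub x s

lemma continuousOn_add_sub (hc : ContinuousOn f (Icc (0 : ℝ) 1))
    (hl : 0 ≤ x - t) (hr : x + t ≤ 1) :
    ContinuousOn (fun s => f (x + s)) (Icc 0 t) ∧ ContinuousOn (fun s => f (x - s)) (Icc 0 t) :=
  ⟨hc.comp (by fun_prop) fun s hs => ⟨by linarith [hs.1, hs.2], by linarith [hs.1, hs.2]⟩,
    hc.comp (by fun_prop) fun s hs => ⟨by linarith [hs.1, hs.2], by linarith [hs.1, hs.2]⟩⟩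

lemma abs_second_difference_le
    (h₁ : ∀ y ∈ Icc (0 : ℝ) 1, HasDerivWithinAt f (f₁ y) (Icc 0 1) y)
    (h₂ : ∀ y ∈ Icc (0 : ℝ) 1, HasDerivWithinAt f₁ (f₂ y) (Icc 0 1) y)
    (hG : ∀ y ∈ Icc (0 : ℝ) 1, |f₂ y| ≤ G) (ht : 0 ≤ t) (hl : 0 ≤ x - t) (hr : x + t ≤ 1) :
    |f (x + t) + f (x - t) - 2 * f x| ≤ G * t ^ 2 := by
  have hc : ContinuousOn f (Icc 0 1) := fun y hy => (h₁ y hy).continuousWithinAt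
  obtain ⟨c1, c2⟩ := continuousOn_add_sub hc hl hr
  refine abs_le_of_abs_deriv_le (F := fun s => f (x + s) + f (x - s) - 2 * f x)
    (F' := fun s => f₁ (x + s) + -f₁ (x - s)) (B := fun s => G * s ^ 2)
    (B' := fun s => G * (2 * s)) ht ((c1.add c2).sub continuousOn_const)
    (fun s hs => ?_) (fun s => ?_) (by simp; ring) (by simp) fun s hs => ?_
  · obtain ⟨a, b⟩ := hasDerivAt_add_sub h₁ hl hr hs
    exact (a.add b).sub_const _
  · simpa using (hasDerivAt_pow 2 s).const_mul G
  · have := abs_sub_le_of_hasDerivWithinAt h₂ hG (x := x - s) (y := x + s)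
      ⟨by linarith [hs.1, hs.2], by linarith [hs.1, hs.2]⟩
      ⟨by linarith [hs.1, hs.2], by linarith [hs.1, hs.2]⟩
    rw [show x + s - (x - s) = 2 * s by ring, abs_of_nonneg (a := 2 * s) (by linarith [hs.1])]
      at this
    rwa [← sub_eq_add_neg]

/-- Here f = u'', so f₂ is the fourth derivative. The previous bound, applied to f, is integrated
twice in the step size, turning G s² into G s³/3 and then G s⁴/12. -/
lemma abs_second_difference_sub_le {u u₁ : ℝ → ℝ}
    (hu : ∀ y ∈ Icc (0 : ℝ) 1, HasDerivWithinAt u (u₁ y) (Icc 0 1) y)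
    (hu₁ : ∀ y ∈ Icc (0 : ℝ) 1, HasDerivWithinAt u₁ (f y) (Icc 0 1) y)
    (h₁ : ∀ y ∈ Icc (0 : ℝ) 1, HasDerivWithinAt f (f₁ y) (Icc 0 1) y)
    (h₂ : ∀ y ∈ Icc (0 : ℝ) 1, HasDerivWithinAt f₁ (f₂ y) (Icc 0 1) y)
    (hG : ∀ y ∈ Icc (0 : ℝ) 1, |f₂ y| ≤ G) (ht : 0 ≤ t) (hl : 0 ≤ x - t) (hr : x + t ≤ 1) :
    |u (x + t) + u (x - t) - 2 * u x - t ^ 2 * f x| ≤ G * t ^ 4 / 12 := by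
  have hc : ContinuousOn u (Icc 0 1) := fun y hy => (hu y hy).continuousWithinAt
  have hc₁ : ContinuousOn u₁ (Icc 0 1) := fun y hy => (hu₁ y hy).continuousWithinAt
  have key : ∀ s ∈ Ico 0 t, |u₁ (x + s) + -u₁ (x - s) - 2 * s * f x| ≤ G * s ^ 3 / 3 := by
    intro s hs
    obtain ⟨c1, c2⟩ := continuousOn_add_sub hc₁ (x := x) (t := s) (by linarith [hs.2])
      (by linarith [hs.2])
    refine abs_le_of_abs_deriv_le (F := fun s => u₁ (x + s) + -u₁ (x - s) - 2 * s * f x)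
      (F' := fun s => f (x + s) + - -f (x - s) - 2 * 1 * f x) (B := fun s => G * s ^ 3 / 3)
      (B' := fun s => G * (3 * s ^ 2) / 3) hs.1 ((c1.add c2.neg).sub (by fun_prop))
      (fun r hr' => ?_) (fun r => ?_) (by simp) (by simp) fun r hr' => ?_
    · obtain ⟨a, b⟩ := hasDerivAt_add_sub hu₁ (x := x) (t := s) (by linarith [hs.2])
        (by linarith [hs.2]) hr'
      exact (a.add b.neg).sub (((hasDerivAt_id r).const_mul 2).mul_const _)
    · simpa using ((hasDerivAt_pow 3 r).const_mul G).div_const 3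
    · have := abs_second_difference_le h₁ h₂ hG hr'.1 (x := x) (by linarith [hs.2, hr'.2])
        (by linarith [hs.2, hr'.2])
      simp only [neg_neg, mul_one]
      linarith
  obtain ⟨c1, c2⟩ := continuousOn_add_sub hc hl hr
  refine abs_le_of_abs_deriv_le (F := fun s => u (x + s) + u (x - s) - 2 * u x - s ^ 2 * f x)
    (F' := fun s => u₁ (x + s) + -u₁ (x - s) - 2 * s * f x) (B := fun s => G * s ^ 4 / 12)
    (B' := fun s => G * (4 * s ^ 3) / 12) ht
    (((c1.add c2).sub continuousOn_const).sub (by fun_prop))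
    (fun s hs => ?_) (fun s => ?_) (by simp; ring) (by simp) fun s hs => ?_
  · obtain ⟨a, b⟩ := hasDerivAt_add_sub hu hl hr hs
    have := (hasDerivAt_pow 2 s).mul_const (f x)
    simp only [Nat.cast_ofNat, Nat.add_one_sub_one, pow_one] at this
    exact ((a.add b).sub_const _).sub this
  · simpa using ((hasDerivAt_pow 4 s).const_mul G).div_const 12
  · have := key s hs
    linarith

end

/-! ### Consistency of the scheme and the resulting eigenvalue error -/

section

variable {n : ℕ} {q : ℝ → ℝ} {μ : ℝ} {u u₁ : ℝ → ℝ}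

lemma abs_sub_eigenvalue_le (h : IsGroundState q μ u u₁) (hq : MapsTo q (Icc 0 1) (Icc 0 1))
    {x : ℝ} (hx : x ∈ Icc (0 : ℝ) 1) : |q x - μ| ≤ 11 :=
  abs_le.2 ⟨by linarith [(hq hx).1, h.mem_Icc.2], by linarith [(hq hx).2, h.mem_Icc.1]⟩

/-- Consistency of the finite difference scheme at a ground state. -/
lemma IsGroundState.abs_fdRow_sub_le (h : IsGroundState q μ u u₁) (hq : q ∈ potentials)
    {i : ℕ} (hi : i < n) :
    |fdRow n q (fun m => u (m / ((n : ℝ) + 1))) i - μ * u (((i + 1 : ℕ) : ℝ) / ((n : ℝ) + 1))|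
      ≤ 12 / ((n : ℝ) + 1) ^ 2 := by
  obtain ⟨hqc, hqm, hqb⟩ := hq
  obtain ⟨d1, d2, -⟩ := hasDerivWithinAt_of_contDiffOn_two hqc
  set q₁ := iteratedDerivWithin 1 q (Icc 0 1)
  set q₂ := iteratedDerivWithin 2 q (Icc 0 1)
  have hN : (0 : ℝ) < (n : ℝ) + 1 := by positivity
  have hiN : (i : ℝ) + 1 ≤ n := by exact_mod_cast hi
  set t := 1 / ((n : ℝ) + 1) with ht
  set x := ((i : ℝ) + 1) / ((n : ℝ) + 1) with hx
  have e0 : (i : ℝ) / ((n : ℝ) + 1) = x - t := by rw [hx, ht]; ring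
  have e2 : ((i : ℝ) + 2) / ((n : ℝ) + 1) = x + t := by rw [hx, ht]; ring
  have hl : 0 ≤ x - t := by rw [← e0]; positivity
  have hr : x + t ≤ 1 := by rw [← e2, div_le_one hN]; linarith
  -- The fourth derivative is q''u + 2q'u' + (q - μ)²u, bounded by 1 + 22 + 121 = 144.
  have hd := abs_second_difference_sub_le (f := fun y => (q y - μ) * u y)
    (f₁ := fun y => q₁ y * u y + (q y - μ) * u₁ y)
    (f₂ := fun y => q₂ y * u y + q₁ y * u₁ y + (q₁ y * u₁ y + (q y - μ) * ((q y - μ) * u y)))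
    (G := 144) h.hasDeriv h.hasDeriv₂
    (fun y hy => ((d1 y hy).sub_const μ).mul (h.hasDeriv y hy))
    (fun y hy => ((d2 y hy).mul (h.hasDeriv y hy)).add
      (((d1 y hy).sub_const μ).mul (h.hasDeriv₂ y hy))) (fun y hy => ?_)
    (x := x) (t := t) (by positivity) hl hr
  · have hx' : (((i + 1 : ℕ) : ℝ) / ((n : ℝ) + 1)) = x := by push_cast; rfl
    have hx2 : (((i + 2 : ℕ) : ℝ) / ((n : ℝ) + 1)) = x + t := by rw [← e2]; push_cast; rfl
    rw [fdRow_eq]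
    rw [e0, hx2, hx']
    have ht2 : ((n : ℝ) + 1) ^ 2 * t ^ 2 = 1 := by rw [ht]; field_simp
    have e : ((n : ℝ) + 1) ^ 2 * (2 * u x - u (x - t) - u (x + t)) + q x * u x - μ * u x
        = -(((n : ℝ) + 1) ^ 2 * (u (x + t) + u (x - t) - 2 * u x - t ^ 2 * ((q x - μ) * u x))) := by
      linear_combination -(((q x - μ) * u x)) * ht2
    rw [e, abs_neg, abs_mul, abs_of_pos (by positivity : (0 : ℝ) < ((n : ℝ) + 1) ^ 2)]
    calc ((n : ℝ) + 1) ^ 2 * _ ≤ ((n : ℝ) + 1) ^ 2 * (144 * t ^ 4 / 12) := by gcongr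
      _ = _ := by rw [ht]; field_simp; norm_num
  · have b0 : |q₁ y| ≤ 1 := hqb 1 (by norm_num) y hy
    have b1 : |q₂ y| ≤ 1 := hqb 2 le_rfl y hy
    have b2 : |u y| ≤ 1 := abs_le.2 ⟨by linarith [h.nonneg hy], h.le_one y hy⟩
    have b3 := h.abs_deriv_le y hy
    have b4 := abs_sub_eigenvalue_le h hqm hy
    have c1 : |q₂ y * u y| ≤ 1 * 1 := by rw [abs_mul]; gcongr
    have c2 : |q₁ y * u₁ y| ≤ 1 * 11 := by rw [abs_mul]; gcongr
    have c3 : |(q y - μ) * ((q y - μ) * u y)| ≤ 11 * (11 * 1) := by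
      rw [abs_mul, abs_mul]; gcongr
    have := abs_add_le (q₂ y * u y + q₁ y * u₁ y)
      (q₁ y * u₁ y + (q y - μ) * ((q y - μ) * u y))
    have := abs_add_le (q₂ y * u y) (q₁ y * u₁ y)
    have := abs_add_le (q₁ y * u₁ y) ((q y - μ) * ((q y - μ) * u y))
    linarith

/-- The scheme is exact on quadratics: K x(1 - x) contributes the constant 2K, which can cancel a
uniform defect. -/
lemma fdRow_add_bump (K : ℝ) (U : ℕ → ℝ) (i : ℕ) :
    fdRow n q (fun m => U m + K * (m / ((n : ℝ) + 1) * (1 - m / ((n : ℝ) + 1)))) i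
      = fdRow n q U i + K * (2 + q (((i : ℝ) + 1) / ((n : ℝ) + 1)) *
        ((((i + 1 : ℕ) : ℝ) / ((n : ℝ) + 1)) * (1 - ((i + 1 : ℕ) : ℝ) / ((n : ℝ) + 1)))) := by
  have hN : ((n : ℝ) + 1) ≠ 0 := by positivity
  simp only [fdRow]
  push_cast
  field_simp
  ring

theorem IsGroundState.abs_sub_fdEigenvalue_le (h : IsGroundState q μ u u₁) (hq : q ∈ potentials)
    (hn : 1 ≤ n) : |μ - fdEigenvalue n q| ≤ 132 / ((n : ℝ) + 1) ^ 2 := by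
  have hqm := hq.2.1
  have hN : (0 : ℝ) < (n : ℝ) + 1 := by positivity
  -- Chosen so that the contribution 2κ of κ x(1 - x) equals the consistency error 12/(n + 1)².
  set κ := 6 / ((n : ℝ) + 1) ^ 2 with hκ
  have hκ0 : 0 < κ := by positivity
  have e12 : 12 / ((n : ℝ) + 1) ^ 2 = 2 * κ := by rw [hκ]; ring
  have e132 : 132 / ((n : ℝ) + 1) ^ 2 = 22 * κ := by rw [hκ]; ring
  rw [e132]
  -- On coarse grids 22κ > 11 and the bound is trivial, as both eigenvalues lie in [0, 11].
  by_cases hbig : κ ≤ 1 / 2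
  swap
  · have h1 := fdEigenvalue_nonneg hn hqm
    have h2 := fdEigenvalue_le_eleven hn hqm
    have := h.mem_Icc.1
    have := h.mem_Icc.2
    rw [abs_le]; constructor <;> linarith
  have hs : ∀ i < n, 0 < ((i + 1 : ℕ) : ℝ) / ((n : ℝ) + 1) *
      (1 - ((i + 1 : ℕ) : ℝ) / ((n : ℝ) + 1)) := fun i hi => by
    have : (i : ℝ) + 1 ≤ n := by exact_mod_cast hi
    have h1 : ((i + 1 : ℕ) : ℝ) / ((n : ℝ) + 1) < 1 := by
      rw [div_lt_one hN]; push_cast; linarith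
    exact mul_pos (by positivity) (sub_pos.2 h1)
  have hmem : ∀ i < n, ((i + 1 : ℕ) : ℝ) / ((n : ℝ) + 1) ∈ Icc (0 : ℝ) 1 := fun i hi => by
    have := node_mem_Icc hi; push_cast; exact this
  have h0 : ∀ K : ℝ, u (((0 : ℕ) : ℝ) / ((n : ℝ) + 1)) + K * (((0 : ℕ) : ℝ) / ((n : ℝ) + 1) *
      (1 - ((0 : ℕ) : ℝ) / ((n : ℝ) + 1))) = 0 := fun K => by simp [h.left]
  have h1 : ∀ K : ℝ, u (((n + 1 : ℕ) : ℝ) / ((n : ℝ) + 1)) + K *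
      (((n + 1 : ℕ) : ℝ) / ((n : ℝ) + 1) * (1 - ((n + 1 : ℕ) : ℝ) / ((n : ℝ) + 1))) = 0 :=
    fun K => by push_cast; rw [div_self hN.ne']; simp [h.right]
  have hcast : ∀ i : ℕ, ((i : ℝ) + 1) / ((n : ℝ) + 1) = ((i + 1 : ℕ) : ℝ) / ((n : ℝ) + 1) :=
    fun i => by push_cast; rfl
  have lower : μ - 22 * κ ≤ fdEigenvalue n q := by
    refine le_fdEigenvalue hn
      (W := fun m => u (m / ((n : ℝ) + 1)) + κ * (m / ((n : ℝ) + 1) * (1 - m / ((n : ℝ) + 1))))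
      (h0 κ) (h1 κ) (fun i hi => ?_) fun i hi => ?_
    · have := h.le_self _ (hmem i hi)
      exact add_pos ((hs i hi).trans_le this) (mul_pos hκ0 (hs i hi))
    · rw [fdRow_add_bump, hcast]
      have a := (abs_le.1 (h.abs_fdRow_sub_le hq hi)).1
      have b := (abs_le.1 (abs_sub_eigenvalue_le h hqm (hmem i hi))).1
      have c := h.le_self _ (hmem i hi)
      have d := hs i hi
      rw [e12] at a
      generalize ((i + 1 : ℕ) : ℝ) / ((n : ℝ) + 1) * (1 - ((i + 1 : ℕ) : ℝ) / ((n : ℝ) + 1)) = s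
        at *
      have k1 : -11 * (κ * s) ≤ (q (((i + 1 : ℕ) : ℝ) / ((n : ℝ) + 1)) - μ) * (κ * s) :=
        mul_le_mul_of_nonneg_right b (by positivity)
      have k2 : κ * s ≤ κ * u (((i + 1 : ℕ) : ℝ) / ((n : ℝ) + 1)) := by gcongr
      have k3 : 0 ≤ κ * (κ * s) := by positivity
      have k4 : 0 ≤ κ * s := by positivity
      nlinarith
  have upper : fdEigenvalue n q ≤ μ + 22 * κ := by
    -- With s = x(1 - x) ≤ u and κ ≤ 1/2, the vector u - κs stays at least s/2. The remaining term
    -- is at most 11κs ≤ 22κ(u - κs), the source of the factor 22.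
    have hW : ∀ i < n, ((i + 1 : ℕ) : ℝ) / ((n : ℝ) + 1) *
        (1 - ((i + 1 : ℕ) : ℝ) / ((n : ℝ) + 1)) / 2 ≤ u (((i + 1 : ℕ) : ℝ) / ((n : ℝ) + 1)) + -κ *
        (((i + 1 : ℕ) : ℝ) / ((n : ℝ) + 1) * (1 - ((i + 1 : ℕ) : ℝ) / ((n : ℝ) + 1))) :=
      fun i hi => by
        have c := h.le_self _ (hmem i hi)
        have d := hs i hi
        nlinarith
    refine fdEigenvalue_le
      (W := fun m => u (m / ((n : ℝ) + 1)) + -κ * (m / ((n : ℝ) + 1) * (1 - m / ((n : ℝ) + 1))))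
      (h0 (-κ)) (h1 (-κ)) ⟨0, hn, ?_⟩ fun i hi => ?_
    · have := hW 0 hn
      have := hs 0 hn
      exact (by linarith : (0 : ℝ) < _).ne'
    · have hWi := hW i hi
      have d := hs i hi
      refine mul_le_mul_of_nonneg_left ?_ (by linarith)
      rw [fdRow_add_bump, hcast]
      have a := (abs_le.1 (h.abs_fdRow_sub_le hq hi)).2
      have b := (abs_le.1 (abs_sub_eigenvalue_le h hqm (hmem i hi))).1
      rw [e12] at a
      generalize ((i + 1 : ℕ) : ℝ) / ((n : ℝ) + 1) * (1 - ((i + 1 : ℕ) : ℝ) / ((n : ℝ) + 1)) = s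
        at *
      have k1 : -11 * (κ * s) ≤ (q (((i + 1 : ℕ) : ℝ) / ((n : ℝ) + 1)) - μ) * (κ * s) :=
        mul_le_mul_of_nonneg_right b (by positivity)
      have k2 := mul_le_mul_of_nonneg_left hWi hκ0.le
      linarith
  rw [abs_le]; constructor <;> linarith

theorem abs_smallestEigenvalue_sub_fdEigenvalue_le (hq : q ∈ potentials) (hn : 1 ≤ n) :
    |smallestEigenvalue q - fdEigenvalue n q| ≤ 132 / (n : ℝ) ^ 2 := by
  obtain ⟨u, u₁, h⟩ := exists_isGroundState_smallestEigenvalue hq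
  refine (h.abs_sub_fdEigenvalue_le hq hn).trans ?_
  have : (0 : ℝ) < n := by exact_mod_cast hn
  gcongr
  linarith

end

/-! ### The lower bound for the number of function values -/

lemma hasDerivAt_max_zero_pow (k : ℕ) (y : ℝ) :
    HasDerivAt (fun y : ℝ => max 0 y ^ (k + 2)) ((k + 2) * max 0 y ^ (k + 1)) y := by
  rcases lt_trichotomy y 0 with hy | rfl | hy
  · rw [max_eq_left hy.le]
    simp only [ne_eq, Nat.add_eq_zero_iff, one_ne_zero, and_false, not_false_eq_true, zero_pow,
      mul_zero]
    refine (hasDerivAt_const y (0 : ℝ)).congr_of_eventuallyEq ?_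
    filter_upwards [gt_mem_nhds hy] with z hz
    simp [max_eq_left hz.le]
  · have : HasFDerivAt (fun y : ℝ => max 0 y ^ (k + 2)) (0 : ℝ →L[ℝ] ℝ) 0 := by
      refine Asymptotics.IsBigO.hasFDerivAt (n := k + 2) (.of_bound 1 ?_) (by omega)
      filter_upwards with z
      rw [sub_zero, norm_pow, norm_pow, norm_norm, one_mul]
      gcongr
      rw [Real.norm_eq_abs, Real.norm_eq_abs, abs_of_nonneg (le_max_left 0 z)]
      exact max_le (abs_nonneg z) (le_abs_self z)
    simpa using this.hasDerivAt
  · have := hasDerivAt_pow (k + 2) y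
    rw [max_eq_right hy.le]
    simp only [Nat.cast_add, Nat.cast_ofNat, Nat.add_one_sub_one] at this
    refine this.congr_of_eventuallyEq ?_
    filter_upwards [lt_mem_nhds hy] with z hz
    simp [max_eq_right hz.le]

/-- A `C²` bump supported in `[0,1]`. -/
def bump (s : ℝ) : ℝ := max 0 (s * (1 - s)) ^ 3

/-- The first derivative of `bump`. -/
def bump₁ (s : ℝ) : ℝ := 3 * max 0 (s * (1 - s)) ^ 2 * (1 - 2 * s)

/-- The second derivative of `bump`. -/
def bump₂ (s : ℝ) : ℝ :=
  6 * max 0 (s * (1 - s)) * (1 - 2 * s) ^ 2 - 6 * max 0 (s * (1 - s)) ^ 2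

lemma hasDerivAt_mul_one_sub (s : ℝ) : HasDerivAt (fun s : ℝ => s * (1 - s)) (1 - 2 * s) s :=
  ((hasDerivAt_id s).mul ((hasDerivAt_id s).const_sub 1)).congr_deriv (by simp; ring)

lemma hasDerivAt_bump (s : ℝ) : HasDerivAt bump (bump₁ s) s := by
  refine ((hasDerivAt_max_zero_pow 1 (s * (1 - s))).comp s
    (hasDerivAt_mul_one_sub s)).congr_deriv ?_
  simp only [bump₁]; push_cast; ring

lemma hasDerivAt_bump₁ (s : ℝ) : HasDerivAt bump₁ (bump₂ s) s := by
  have h1 : HasDerivAt (fun s : ℝ => 1 - 2 * s) (-2) s := by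
    simpa using ((hasDerivAt_id s).const_mul (2 : ℝ)).const_sub 1
  refine ((((hasDerivAt_max_zero_pow 0 (s * (1 - s))).comp s
    (hasDerivAt_mul_one_sub s)).const_mul 3).mul h1).congr_deriv ?_
  simp only [bump₂, Function.comp]; push_cast; ring

lemma continuous_bump₂ : Continuous bump₂ := by unfold bump₂; fun_prop

lemma max_zero_mul_one_sub_eq_zero {s : ℝ} (h : s ∉ Ioo (0 : ℝ) 1) :
    max 0 (s * (1 - s)) = 0 := by
  refine max_eq_left ?_
  rcases le_or_gt s 0 with h0 | h0
  · exact mul_nonpos_of_nonpos_of_nonneg h0 (by linarith)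
  · have : 1 ≤ s := by by_contra! hs; exact h ⟨h0, hs⟩
    exact mul_nonpos_of_nonneg_of_nonpos h0.le (by linarith)

lemma bump_nonneg (s : ℝ) : 0 ≤ bump s := pow_nonneg (le_max_left _ _) 3

lemma bump_eq_zero {s : ℝ} (h : s ∉ Ioo (0 : ℝ) 1) : bump s = 0 := by
  simp [bump, max_zero_mul_one_sub_eq_zero h]

lemma bump₁_eq_zero {s : ℝ} (h : s ∉ Ioo (0 : ℝ) 1) : bump₁ s = 0 := by
  simp [bump₁, max_zero_mul_one_sub_eq_zero h]

lemma bump₂_eq_zero {s : ℝ} (h : s ∉ Ioo (0 : ℝ) 1) : bump₂ s = 0 := by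
  simp [bump₂, max_zero_mul_one_sub_eq_zero h]

lemma max_zero_mul_one_sub_le (s : ℝ) : max 0 (s * (1 - s)) ≤ 1 / 4 :=
  max_le (by norm_num) (by nlinarith [sq_nonneg (s - 1 / 2)])

lemma abs_bump_le (s : ℝ) : |bump s| ≤ 2 := by
  rw [abs_of_nonneg (bump_nonneg s), bump]
  calc _ ≤ (1 / 4 : ℝ) ^ 3 := pow_le_pow_left₀ (le_max_left _ _) (max_zero_mul_one_sub_le s) 3
    _ ≤ 2 := by norm_num

lemma abs_bump₁_le (s : ℝ) : |bump₁ s| ≤ 2 := by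
  by_cases h : s ∈ Ioo (0 : ℝ) 1
  · have h1 : |1 - 2 * s| ≤ 1 := abs_le.2 ⟨by linarith [h.2], by linarith [h.1]⟩
    have h2 : max 0 (s * (1 - s)) ^ 2 ≤ (1 / 4) ^ 2 :=
      pow_le_pow_left₀ (le_max_left _ _) (max_zero_mul_one_sub_le s) 2
    rw [bump₁, abs_mul, abs_of_nonneg (by positivity)]
    calc _ ≤ 3 * (1 / 4 : ℝ) ^ 2 * 1 := by gcongr
      _ ≤ 2 := by norm_num
  · rw [bump₁_eq_zero h]; norm_num

lemma abs_bump₂_le (s : ℝ) : |bump₂ s| ≤ 2 := by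
  by_cases h : s ∈ Ioo (0 : ℝ) 1
  · have h1 : (1 - 2 * s) ^ 2 ≤ 1 := by nlinarith [h.1, h.2]
    have h0 : 0 ≤ max 0 (s * (1 - s)) := le_max_left _ _
    have h2 := max_zero_mul_one_sub_le s
    have h3 : max 0 (s * (1 - s)) * (1 - 2 * s) ^ 2 ≤ 1 / 4 * 1 := by gcongr
    have h4 : 0 ≤ max 0 (s * (1 - s)) * (1 - 2 * s) ^ 2 := by positivity
    rw [bump₂, abs_le]
    constructor <;> nlinarith
  · rw [bump₂_eq_zero h]; norm_num

/-- Integer translates have disjoint supports, so at most one summand is nonzero at any point. -/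
lemma abs_sum_translates_le {F : ℝ → ℝ} {B : ℝ} (hB0 : 0 ≤ B) (hF : ∀ s ∉ Ioo (0 : ℝ) 1, F s = 0)
    (hB : ∀ s, |F s| ≤ B) (J : Finset ℕ) (y : ℝ) : |∑ j ∈ J, F (y - j)| ≤ B := by
  by_cases h : ∀ j ∈ J, F (y - j) = 0
  · rw [Finset.sum_eq_zero h]; simpa using hB0
  · push Not at h
    obtain ⟨j, hj, hne⟩ := h
    rw [Finset.sum_eq_single_of_mem j hj fun i _ hij => ?_]
    · exact hB _
    · refine hF _ fun hi => hij ?_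
      have hj' : y - j ∈ Ioo (0 : ℝ) 1 := by by_contra hc; exact hne (hF _ hc)
      have h1 : (i : ℝ) < j + 1 := by linarith [hi.1, hj'.2]
      have h2 : (j : ℝ) < i + 1 := by linarith [hi.2, hj'.1]
      have h1' : i < j + 1 := by exact_mod_cast h1
      have h2' : j < i + 1 := by exact_mod_cast h2
      omega

/-- The constant potential `1`, lowered by bumps in the cells `[j/S, (j+1)/S]`, `j ∈ J`. -/
def loweredPotential (S : ℝ) (J : Finset ℕ) (x : ℝ) : ℝ :=
  1 - 1 / (2 * S ^ 2) * ∑ j ∈ J, bump (S * x - j)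

lemma mem_potentials_of_hasDerivAt {q q₁ q₂ : ℝ → ℝ} (h₁ : ∀ x, HasDerivAt q (q₁ x) x)
    (h₂ : ∀ x, HasDerivAt q₁ (q₂ x) x) (hc : Continuous q₂)
    (h0 : ∀ x, q x ∈ Icc (0 : ℝ) 1) (hb₁ : ∀ x, |q₁ x| ≤ 1) (hb₂ : ∀ x, |q₂ x| ≤ 1) :
    q ∈ potentials := by
  have d₁ := fun x (_ : x ∈ Icc (0 : ℝ) 1) => (h₁ x).hasDerivWithinAt (s := Icc 0 1)
  have d₂ := fun x (_ : x ∈ Icc (0 : ℝ) 1) => (h₂ x).hasDerivWithinAt (s := Icc 0 1)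
  obtain ⟨e1, e2⟩ := iteratedDerivWithin_one_two_eq d₁ d₂
  refine ⟨contDiffOn_two_of_hasDerivWithinAt d₁ d₂ hc.continuousOn, fun x _ => h0 x,
    fun i hi x hx => ?_⟩
  interval_cases i
  · rw [iteratedDerivWithin_zero, abs_of_nonneg (h0 x).1]; exact (h0 x).2
  · rw [e1 hx]; exact hb₁ x
  · rw [e2 hx]; exact hb₂ x

lemma one_mem_potentials : (fun _ => 1 : ℝ → ℝ) ∈ potentials :=
  mem_potentials_of_hasDerivAt (q₁ := fun _ => 0) (q₂ := fun _ => 0)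
    (fun x => hasDerivAt_const x 1) (fun x => hasDerivAt_const x 0) continuous_const
    (by simp) (by simp) (by simp)

/-- The factor 1/(2S²) balances the S² from differentiating twice: the second derivative is half a
sum bounded by 2, and the lower derivatives gain powers of 1/S. -/
lemma loweredPotential_mem {S : ℝ} (hS : 1 ≤ S) (J : Finset ℕ) :
    loweredPotential S J ∈ potentials := by
  have hS0 : S ≠ 0 := by positivity
  have hlin : ∀ (j : ℕ) (x : ℝ), HasDerivAt (fun x => S * x - j) S x := fun j x => by
    simpa using ((hasDerivAt_id x).const_mul S).sub_const (j : ℝ)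
  refine mem_potentials_of_hasDerivAt
    (q₁ := fun x => -(1 / (2 * S) * ∑ j ∈ J, bump₁ (S * x - j)))
    (q₂ := fun x => -(1 / 2 * ∑ j ∈ J, bump₂ (S * x - j))) (fun x => ?_) (fun x => ?_) ?_
    (fun x => ?_) (fun x => ?_) (fun x => ?_)
  · refine (((HasDerivAt.fun_sum fun (j : ℕ) _ => (hasDerivAt_bump (S * x - j)).comp x
      (hlin j x)).const_mul (1 / (2 * S ^ 2))).const_sub 1).congr_deriv ?_
    rw [← Finset.sum_mul]; field_simp
  · refine (((HasDerivAt.fun_sum fun (j : ℕ) _ => (hasDerivAt_bump₁ (S * x - j)).comp x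
      (hlin j x)).const_mul (1 / (2 * S))).neg).congr_deriv ?_
    rw [← Finset.sum_mul]; field_simp
  · have := continuous_bump₂
    fun_prop
  · have h := abs_sum_translates_le (by norm_num) (fun s => bump_eq_zero) abs_bump_le J (S * x)
    have h0 : 0 ≤ ∑ j ∈ J, bump (S * x - j) := Finset.sum_nonneg fun j _ => bump_nonneg _
    rw [abs_of_nonneg h0] at h
    have h1 : 1 / (2 * S ^ 2) ≤ 1 / 2 := by
      apply one_div_le_one_div_of_le <;> nlinarith
    have h2 : 1 / (2 * S ^ 2) * ∑ j ∈ J, bump (S * x - j) ≤ 1 / 2 * 2 := by gcongr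
    have h3 : 0 ≤ 1 / (2 * S ^ 2) * ∑ j ∈ J, bump (S * x - j) := by positivity
    simp only [loweredPotential]
    constructor <;> linarith
  · have h := abs_sum_translates_le (by norm_num) (fun s => bump₁_eq_zero) abs_bump₁_le J (S * x)
    have h1 : 1 / (2 * S) ≤ 1 / 2 := by
      apply one_div_le_one_div_of_le <;> linarith
    rw [abs_neg, abs_mul, abs_of_nonneg (by positivity)]
    calc _ ≤ (1 / 2 : ℝ) * 2 := by gcongr
      _ = 1 := by norm_num
  · have h := abs_sum_translates_le (by norm_num) (fun s => bump₂_eq_zero) abs_bump₂_le J (S * x)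
    rw [abs_neg, abs_mul, abs_of_nonneg (by positivity)]
    linarith

/-! ### Effect of lowering the potential on the smallest eigenvalue -/

lemma integral_bump_mul_ge {v : ℝ → ℝ} (hv : ContinuousOn v (Icc 0 1))
    (hvle : ∀ x ∈ Icc (0 : ℝ) 1, x * (1 - x) ≤ v x) {S : ℝ} (hS : 0 < S) {j : ℕ}
    (hj : S ≤ 4 * j) (hj' : 4 * ((j : ℝ) + 1) ≤ 3 * S) :
    1 / (10240 * S) ≤ ∫ x in (0 : ℝ)..1, bump (S * x - j) * v x ^ 2 := by
  have hbc : Continuous bump := by unfold bump; fun_prop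
  have hcont : ContinuousOn (fun x => bump (S * x - j) * v x ^ 2) (Icc 0 1) := by fun_prop
  set a := ((j : ℝ) + 1 / 4) / S with ha
  set b := ((j : ℝ) + 3 / 4) / S with hb
  have hSa : S * a = (j : ℝ) + 1 / 4 := by rw [ha]; field_simp
  have hSb : S * b = (j : ℝ) + 3 / 4 := by rw [hb]; field_simp
  have ha' : 1 / 4 ≤ a := by rw [ha, le_div_iff₀ hS]; linarith
  have hb' : b ≤ 3 / 4 := by rw [hb, div_le_iff₀ hS]; linarith
  have hab : a ≤ b := by rw [ha, hb]; gcongr; norm_num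
  have h1 : ∫ x in a..b, bump (S * x - j) * v x ^ 2
      ≤ ∫ x in (0 : ℝ)..1, bump (S * x - j) * v x ^ 2 := by
    refine intervalIntegral.integral_mono_interval (by linarith) hab (by linarith) ?_
      (ContinuousOn.intervalIntegrable (by rwa [uIcc_of_le zero_le_one]))
    exact Eventually.of_forall fun x => mul_nonneg (bump_nonneg _) (sq_nonneg _)
  have h2 : ∫ _ in a..b, (1 / 5120 : ℝ) ≤ ∫ x in a..b, bump (S * x - j) * v x ^ 2 := by
    refine intervalIntegral.integral_mono_on hab (by simp)
      (ContinuousOn.intervalIntegrable ?_) fun x hx => ?_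
    · rw [uIcc_of_le hab]
      exact hcont.mono (Icc_subset_Icc (by linarith) (by linarith))
    · have hx0 : 1 / 4 ≤ x := ha'.trans hx.1
      have hx1 : x ≤ 3 / 4 := hx.2.trans hb'
      have hvx : 3 / 16 ≤ v x := le_trans (by nlinarith) (hvle x ⟨by linarith, by linarith⟩)
      have hs0 : 1 / 4 ≤ S * x - j := by
        have := mul_le_mul_of_nonneg_left hx.1 hS.le; linarith
      have hs1 : S * x - j ≤ 3 / 4 := by
        have := mul_le_mul_of_nonneg_left hx.2 hS.le; linarith
      have hm : 3 / 16 ≤ max 0 ((S * x - j) * (1 - (S * x - j))) :=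
        le_max_of_le_right (by nlinarith)
      have hbx : (3 / 16 : ℝ) ^ 3 ≤ bump (S * x - j) :=
        pow_le_pow_left₀ (by norm_num) hm 3
      -- On the middle half of the cell the bump is at least (3/16)³, and v ≥ 3/16 because the cell
      -- lies in [1/4, 3/4]. The middle half has length 1/(2S).
      calc (1 / 5120 : ℝ) ≤ (3 / 16) ^ 3 * (3 / 16) ^ 2 := by norm_num
        _ ≤ _ := mul_le_mul hbx (pow_le_pow_left₀ (by norm_num) hvx 2) (by norm_num)
          (bump_nonneg _)
  refine le_trans (le_of_eq ?_) (h2.trans h1)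
  rw [intervalIntegral.integral_const, smul_eq_mul, ha, hb]
  field_simp
  norm_num

/-- Lowering the potential `1` in many cells lowers the smallest eigenvalue. -/
lemma integral_le_smallestEigenvalue_sub {q : ℝ → ℝ} (hq : q ∈ potentials) {v v₁ : ℝ → ℝ} {μ : ℝ}
    (hv : IsGroundState (fun _ => 1) μ v v₁) :
    ∫ x in (0 : ℝ)..1, (1 - q x) * v x ^ 2
      ≤ (μ - smallestEigenvalue q) * ∫ x in (0 : ℝ)..1, v x ^ 2 := by
  obtain ⟨w, w₁, hw⟩ := exists_isGroundState_smallestEigenvalue hq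
  have hqc := potentials.continuousOn hq
  have hvc := hv.continuousOn
  have hvc₁ := hv.continuousOn₁
  -- The ground state of the potential 1 serves as test function in the variational inequality for
  -- q.
  have a := hw.integral_nonneg hqc hv.hasDeriv hvc₁ hv.left hv.right
  have b := hv.integral_eq_zero continuousOn_const hv.left hv.right
  have e : ∫ x in (0 : ℝ)..1, (v₁ x ^ 2 + (q x - smallestEigenvalue q) * v x ^ 2)
      = (∫ x in (0 : ℝ)..1, (v₁ x ^ 2 + (1 - μ) * v x ^ 2))
        + ((μ - smallestEigenvalue q) * (∫ x in (0 : ℝ)..1, v x ^ 2)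
        - ∫ x in (0 : ℝ)..1, (1 - q x) * v x ^ 2) := by
    rw [← intervalIntegral.integral_const_mul, ← intervalIntegral.integral_sub,
      ← intervalIntegral.integral_add]
    · congr 1; ext x; ring
    all_goals exact ContinuousOn.intervalIntegrable (by rw [uIcc_of_le zero_le_one]; fun_prop)
  rw [b] at e
  linarith

/-- A fooling potential: it cannot be distinguished from the constant `1` at the points of `P`. -/
lemma exists_fooling_potential (P : Finset ℝ) (N : ℕ) (hP : P.card ≤ N) :
    ∃ q ∈ potentials, (∀ t ∈ P, q t = 1) ∧
      1 / (1310720 * ((N : ℝ) + 1) ^ 2) ≤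
        smallestEigenvalue (fun _ => 1) - smallestEigenvalue q := by
  classical
  -- Of 4(N + 1) cells, the 2(N + 1) with index in [N + 1, 3(N + 1)) fill [1/4, 3/4]; N points hit
  -- at most N of them. The N + 1 cells left give (N + 1)/(20480 S³), the stated constant.
  set S : ℝ := 4 * ((N : ℝ) + 1) with hS
  have hS1 : 1 ≤ S := by rw [hS]; linarith [(Nat.cast_nonneg N : (0 : ℝ) ≤ N)]
  have hS0 : 0 < S := by positivity
  set J : Finset ℕ := Finset.Ico (N + 1) (3 * (N + 1)) \ P.image (fun t => ⌊S * t⌋₊) with hJ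
  have hcard : N + 1 ≤ J.card := by
    have h1 : _ ≤ J.card := Finset.le_card_sdiff (P.image (fun t => ⌊S * t⌋₊))
      (Finset.Ico (N + 1) (3 * (N + 1)))
    have h2 := Finset.card_image_le (s := P) (f := fun t => ⌊S * t⌋₊)
    rw [Nat.card_Ico] at h1
    omega
  have hJmem : ∀ j ∈ J, S ≤ 4 * j ∧ 4 * ((j : ℝ) + 1) ≤ 3 * S := fun j hj => by
    obtain ⟨h1, h2⟩ := Finset.mem_Ico.1 (Finset.mem_sdiff.1 hj).1
    have h1' : (N : ℝ) + 1 ≤ j := by exact_mod_cast h1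
    have h2' : (j : ℝ) + 1 ≤ 3 * ((N : ℝ) + 1) := by exact_mod_cast h2
    constructor <;> linarith
  refine ⟨loweredPotential S J, loweredPotential_mem hS1 J, fun t ht => ?_, ?_⟩
  · simp only [loweredPotential]
    rw [Finset.sum_eq_zero fun j hj => ?_, mul_zero, sub_zero]
    refine bump_eq_zero fun hmem => (Finset.mem_sdiff.1 hj).2 (Finset.mem_image.2 ⟨t, ht, ?_⟩)
    have hj0 : (0 : ℝ) ≤ j := Nat.cast_nonneg j
    rw [Nat.floor_eq_iff (by linarith [hmem.1])]
    exact ⟨by linarith [hmem.1], by linarith [hmem.2]⟩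
  · obtain ⟨v, v₁, hv⟩ := exists_isGroundState_smallestEigenvalue one_mem_potentials
    have key := integral_le_smallestEigenvalue_sub (loweredPotential_mem hS1 J) hv
    have hvc := hv.continuousOn
    have hbc : Continuous bump := by unfold bump; fun_prop
    have hint : ∫ x in (0 : ℝ)..1, (1 - loweredPotential S J x) * v x ^ 2
        = 1 / (2 * S ^ 2) * ∑ j ∈ J, ∫ x in (0 : ℝ)..1, bump (S * x - j) * v x ^ 2 := by
      rw [← intervalIntegral.integral_finsetSum fun j _ => ContinuousOn.intervalIntegrable (by
        rw [uIcc_of_le zero_le_one]; fun_prop), ← intervalIntegral.integral_const_mul]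
      congr 1
      ext x
      rw [loweredPotential, sub_sub_cancel, mul_assoc, Finset.sum_mul]
    have hsum : ((N : ℝ) + 1) * (1 / (10240 * S))
        ≤ ∑ j ∈ J, ∫ x in (0 : ℝ)..1, bump (S * x - j) * v x ^ 2 := by
      calc ((N : ℝ) + 1) * (1 / (10240 * S)) ≤ (J.card : ℝ) * (1 / (10240 * S)) := by
            gcongr; exact_mod_cast hcard
        _ = ∑ j ∈ J, 1 / (10240 * S) := by rw [Finset.sum_const, nsmul_eq_mul]
        _ ≤ _ := Finset.sum_le_sum fun j hj =>
            integral_bump_mul_ge hvc hv.le_self hS0 (hJmem j hj).1 (hJmem j hj).2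
    have hA : 1 / (1310720 * ((N : ℝ) + 1) ^ 2)
        ≤ ∫ x in (0 : ℝ)..1, (1 - loweredPotential S J x) * v x ^ 2 := by
      rw [hint]
      refine le_trans (le_of_eq ?_) (mul_le_mul_of_nonneg_left hsum (by positivity))
      rw [hS]; field_simp; norm_num
    have hI0 : 0 ≤ ∫ x in (0 : ℝ)..1, v x ^ 2 :=
      intervalIntegral.integral_nonneg zero_le_one fun x _ => sq_nonneg _
    have hI1 : ∫ x in (0 : ℝ)..1, v x ^ 2 ≤ 1 := by
      have : ∫ x in (0 : ℝ)..1, v x ^ 2 ≤ ∫ _ in (0 : ℝ)..1, (1 : ℝ) :=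
        intervalIntegral.integral_mono_on zero_le_one
          (ContinuousOn.intervalIntegrable (by rw [uIcc_of_le zero_le_one]; fun_prop)) (by simp)
          fun x hx => pow_le_one₀ (hv.nonneg hx) (hv.le_one x hx)
      simpa using this
    have hc : 0 < 1 / (1310720 * ((N : ℝ) + 1) ^ 2) := by positivity
    rcases le_or_gt (smallestEigenvalue (fun _ => 1) - smallestEigenvalue (loweredPotential S J)) 0
      with hd | hd
    · linarith [mul_nonpos_of_nonpos_of_nonneg hd hI0]
    · linarith [mul_le_of_le_one_right hd.le hI1]

/-- The points at which an algorithm samples the constant potential `1`. -/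
lemma SamplingAlgorithm.exists_finset (q₀ : ℝ → ℝ) (φ : SamplingAlgorithm) :
    ∃ P : Finset ℝ, P.card ≤ φ.evals q₀ ∧
      ∀ q : ℝ → ℝ, (∀ t ∈ P, q t = q₀ t) → φ.value q = φ.value q₀ := by
  classical
  induction φ with
  | output y => exact ⟨∅, by simp, fun q _ => rfl⟩
  | sample t next ih =>
    -- Only the branch followed for `q₀` matters: a function agreeing with `q₀` at its nodes follows
    -- the same branch, however adaptive the algorithm is.
    obtain ⟨P, hP, h⟩ := ih (q₀ t)
    refine ⟨insert (t : ℝ) P, (Finset.card_insert_le _ _).trans (by simpa [evals] using hP),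
      fun q hq => ?_⟩
    simp only [value]
    rw [hq t (Finset.mem_insert_self _ _)]
    exact h q fun s hs => hq s (Finset.mem_insert_of_mem hs)

lemma SamplingAlgorithm.abs_sub_value_le {φ : SamplingAlgorithm} {ε : ℝ} (hε : 0 ≤ ε)
    (h : φ.worstError ≤ ENNReal.ofReal ε) {q : ℝ → ℝ} (hq : q ∈ potentials) :
    |smallestEigenvalue q - φ.value q| ≤ ε := by
  have h1 := (iSup₂_le_iff.1 h) q hq
  exact (ENNReal.ofReal_le_ofReal_iff hε).1 h1

lemma sq_rpow_neg_half {ε : ℝ} (hε : 0 < ε) : (ε ^ (-(1 / 2) : ℝ)) ^ 2 = ε⁻¹ := by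
  rw [← Real.rpow_natCast, ← Real.rpow_mul hε.le]
  norm_num
  exact Real.rpow_neg_one ε

/-- Every algorithm with error `ε` needs of the order of `ε^(-1/2)` values of the potential `1`. -/
theorem SamplingAlgorithm.le_evals {φ : SamplingAlgorithm} {ε : ℝ} (hε : 0 < ε)
    (hε₀ : ε ≤ 1 / 10497600) (h : φ.worstError ≤ ENNReal.ofReal ε) :
    1 / 3240 * ε ^ (-(1 / 2) : ℝ) ≤ (φ.evals (fun _ => 1) : ℝ) := by
  obtain ⟨P, hP, hval⟩ := φ.exists_finset (fun _ => 1)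
  obtain ⟨q, hq, hqP, hgap⟩ := exists_fooling_potential P _ hP
  have h1 := abs_le.1 (abs_sub_value_le hε.le h one_mem_potentials)
  have h2 := abs_le.1 (abs_sub_value_le hε.le h hq)
  rw [hval q hqP] at h2
  set N : ℝ := (φ.evals (fun _ => 1) : ℝ)
  have hN : 0 ≤ N := Nat.cast_nonneg _
  set s := ε ^ (-(1 / 2) : ℝ)
  have hs0 : 0 < s := Real.rpow_pos_of_pos hε _
  have hs : s ^ 2 = ε⁻¹ := sq_rpow_neg_half hε
  -- One output serves both potentials, so their eigenvalues differ by at most 2ε.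
  have hle : 1 / (1310720 * (N + 1) ^ 2) ≤ 2 * ε := by linarith [h1.2, h2.1]
  have h3 : s ^ 2 ≤ 2621440 * (N + 1) ^ 2 := by
    rw [hs, inv_le_iff_one_le_mul₀ hε]
    rw [div_le_iff₀ (by positivity)] at hle
    linarith
  -- 1620² ≥ 2621440. The threshold on ε is 3240⁻², so s ≥ 3240 and the 1 in N + 1 costs at most a
  -- factor of 2.
  have h4 : s ≤ 1620 * (N + 1) := by
    refine (pow_le_pow_iff_left₀ hs0.le (by positivity) two_ne_zero).1 ?_
    nlinarith [sq_nonneg (N + 1)]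
  have h5 : 3240 ≤ s := by
    refine (pow_le_pow_iff_left₀ (by norm_num) hs0.le two_ne_zero).1 ?_
    rw [hs, le_inv_comm₀ (by norm_num) hε]
    norm_num
    linarith
  linarith

/-! ### Computation trees as sampling algorithms -/

open Classical in
/-- Forget the operations of a computation tree, keeping its function evaluations. -/
def ComputationTree.toSampling : ComputationTree → (ℕ → ℝ) → SamplingAlgorithm
  | output a, s => .output (a.value s)
  | arith dst f a b next, s =>
      (f.eval (a.value s) (b.value s)).elim (.output 0) fun y =>
        toSampling next (Function.update s dst y)
  | elem dst f a next, s =>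
      (f.eval (a.value s)).elim (.output 0) fun y => toSampling next (Function.update s dst y)
  | compare a b ifLE ifGT, s =>
      if a.value s ≤ b.value s then toSampling ifLE s else toSampling ifGT s
  | sample dst t next, s =>
      if h : t.value s ∈ Icc (0 : ℝ) 1 then
        .sample ⟨t.value s, h⟩ fun y => toSampling next (Function.update s dst y)
      else .output 0

namespace ComputationTree

/-- Only successful runs are compared, so the default output 0 on failure is harmless. -/
lemma toSampling_spec {q : ℝ → ℝ} (T : ComputationTree) (s : ℕ → ℝ) {r : Outcome}
    (h : T.run q s = some r) :
    (T.toSampling s).value q = r.value ∧ (T.toSampling s).evals q = r.evals := by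
  induction T generalizing s r with
  | output a =>
    simp only [run, Option.some.injEq] at h
    subst h
    exact ⟨rfl, rfl⟩
  | arith dst f a b next ih =>
    simp only [run, Option.bind_eq_some_iff, Option.map_eq_some_iff] at h
    obtain ⟨y, hy, r', hr', rfl⟩ := h
    simp only [toSampling, hy, Option.elim_some]
    have h' := ih _ hr'
    exact h'
  | elem dst f a next ih =>
    simp only [run, Option.bind_eq_some_iff, Option.map_eq_some_iff] at h
    obtain ⟨y, hy, r', hr', rfl⟩ := h
    simp only [toSampling, hy, Option.elim_some]
    have h' := ih _ hr'
    exact h'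
  | compare a b ifLE ifGT ih₁ ih₂ =>
    simp only [run, Option.map_eq_some_iff] at h
    obtain ⟨r', hr', rfl⟩ := h
    simp only [toSampling]
    split_ifs at hr' ⊢ with hc
    · have h' := ih₁ _ hr'
      exact h'
    · have h' := ih₂ _ hr'
      exact h'
  | sample dst t next ih =>
    simp only [run] at h
    split_ifs at h with hc
    · simp only [Option.map_eq_some_iff] at h
      obtain ⟨r', hr', rfl⟩ := h
      have := ih _ hr'
      simp only [toSampling, dif_pos hc, SamplingAlgorithm.value, SamplingAlgorithm.evals]
      exact ⟨this.1, by rw [this.2]; rfl⟩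

/-- The sampling algorithm defined by a computation tree. -/
def sampling (T : ComputationTree) : SamplingAlgorithm := T.toSampling fun _ => 0

lemma sampling_spec {q : ℝ → ℝ} {T : ComputationTree} {r : Outcome} (h : T.exec q = some r) :
    T.sampling.value q = r.value ∧ T.sampling.evals q = r.evals := T.toSampling_spec _ h

lemma exists_exec_of_worstError_le {T : ComputationTree} {ε : ℝ}
    (h : T.worstError ≤ ENNReal.ofReal ε) {q : ℝ → ℝ} (hq : q ∈ potentials) :
    ∃ r, T.exec q = some r ∧
      ENNReal.ofReal |smallestEigenvalue q - r.value| ≤ ENNReal.ofReal ε := by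
  have h1 := (iSup₂_le_iff.1 h) q hq
  cases hr : T.exec q with
  | none => simp [hr] at h1
  | some r => exact ⟨r, rfl, by simpa [hr] using h1⟩

lemma worstError_sampling_le {T : ComputationTree} {ε : ℝ}
    (h : T.worstError ≤ ENNReal.ofReal ε) : T.sampling.worstError ≤ ENNReal.ofReal ε := by
  refine iSup₂_le fun q hq => ?_
  obtain ⟨r, hr, hle⟩ := exists_exec_of_worstError_le h hq
  rwa [(sampling_spec hr).1]

/-! ### Bisection as a computation tree -/

/-- The computation outputs `v` after `e` function evaluations and at most `m` operations. -/
def Runs (q : ℝ → ℝ) (T : ComputationTree) (s : ℕ → ℝ) (v : ℝ) (e m : ℕ) : Prop :=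
  ∃ r, T.run q s = some r ∧ r.value = v ∧ r.evals = e ∧ r.ops ≤ m

variable {q : ℝ → ℝ} {s : ℕ → ℝ} {v : ℝ} {e m : ℕ}

lemma Runs.output {a : Operand} (h : a.value s = v) : Runs q (output a) s v 0 0 :=
  ⟨_, rfl, h, rfl, le_rfl⟩

lemma Runs.arith {dst : ℕ} {f : ArithOp} {a b : Operand} {next : ComputationTree} {y : ℝ}
    (hy : f.eval (a.value s) (b.value s) = some y)
    (h : Runs q next (Function.update s dst y) v e m) :
    Runs q (arith dst f a b next) s v e (m + 1) := by
  obtain ⟨r, hr, h1, h2, h3⟩ := h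
  exact ⟨r.addOp, by simp [run, hy, hr], h1, h2, Nat.succ_le_succ h3⟩

lemma Runs.compare {a b : Operand} {T₁ T₂ : ComputationTree}
    (h₁ : a.value s ≤ b.value s → Runs q T₁ s v e m)
    (h₂ : b.value s < a.value s → Runs q T₂ s v e m) :
    Runs q (compare a b T₁ T₂) s v e (m + 1) := by
  by_cases hc : a.value s ≤ b.value s
  · obtain ⟨r, hr, h1, h2, h3⟩ := h₁ hc
    exact ⟨r.addOp, by simp [run, hc, hr], h1, h2, Nat.succ_le_succ h3⟩
  · obtain ⟨r, hr, h1, h2, h3⟩ := h₂ (not_le.1 hc)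
    exact ⟨r.addOp, by simp [run, hc, hr], h1, h2, Nat.succ_le_succ h3⟩

lemma Runs.sample {dst : ℕ} {t : Operand} {next : ComputationTree}
    (ht : t.value s ∈ Icc (0 : ℝ) 1)
    (h : Runs q next (Function.update s dst (q (t.value s))) v e m) :
    Runs q (sample dst t next) s v (e + 1) m := by
  obtain ⟨r, hr, h1, h2, h3⟩ := h
  refine ⟨r.addEval, ?_, h1, by rw [Outcome.addEval, h2], h3⟩
  rw [run, if_pos ht, hr]; rfl

lemma Runs.mono {T : ComputationTree} {m' : ℕ} (h : Runs q T s v e m) (hm : m ≤ m') :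
    Runs q T s v e m' := by
  obtain ⟨r, hr, h1, h2, h3⟩ := h
  exact ⟨r, hr, h1, h2, h3.trans hm⟩

open Operand ArithOp

/-- Compute `m` more terms of the Sturm sequence, starting after the term of index `k`. Register
`2` holds the argument, registers `3` and `4` the last two terms, and registers `7, 8, …` the
diagonal of the matrix. Continue with `neg` as soon as a term is not positive, and with `pos` if
there is no such term. -/
def sturmTree (n : ℕ) (pos neg : ComputationTree) : ℕ → ℕ → ComputationTree
  | 0, _ => pos
  | m + 1, k =>
      .arith 5 sub (reg (7 + k)) (reg 2) <| .arith 5 mul (reg 5) (reg 4) <|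
      .arith 6 mul (const (((n : ℝ) + 1) ^ 4)) (reg 3) <| .arith 3 add (reg 4) (const 0) <|
      .arith 4 sub (reg 5) (reg 6) <|
      .compare (reg 4) (const 0) neg (sturmTree n pos neg m (k + 1))

/-- Perform `k` bisection steps on the interval in registers `0` and `1`. -/
def bisectTree (n : ℕ) : ℕ → ComputationTree
  | 0 => .arith 2 add (reg 0) (reg 1) <| .arith 2 div (reg 2) (const 2) <| .output (reg 2)
  | k + 1 => .arith 2 add (reg 0) (reg 1) <| .arith 2 div (reg 2) (const 2) <|
      .arith 3 add (const 0) (const 0) <| .arith 4 add (const 1) (const 0) <|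
      sturmTree n (.arith 0 add (reg 2) (const 0) (bisectTree n k))
        (.arith 1 add (reg 2) (const 0) (bisectTree n k)) n 0

/-- Sample the potential at `m` grid points, starting with index `i`, and store the diagonal of the
matrix; then initialise the interval and continue with `next`. -/
def loadTree (n : ℕ) (next : ComputationTree) : ℕ → ℕ → ComputationTree
  | 0, _ => .arith 1 add (const 11) (const 0) next
  | m + 1, i => .sample (7 + i) (const (((i : ℝ) + 1) / ((n : ℝ) + 1))) <|
      .arith (7 + i) add (reg (7 + i)) (const (2 * ((n : ℝ) + 1) ^ 2)) <|
      loadTree n next m (i + 1)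

/-- Diagonal entry of the finite difference matrix. -/
def diagEntry (n : ℕ) (q : ℝ → ℝ) (i : ℕ) : ℝ :=
  2 * ((n : ℝ) + 1) ^ 2 + q (((i : ℝ) + 1) / ((n : ℝ) + 1))

/-- The term before the term of index `k` of the Sturm sequence, with value `0` for `k = 0`. -/
def sturmPrev (n : ℕ) (q : ℝ → ℝ) (x : ℝ) : ℕ → ℝ
  | 0 => 0
  | k + 1 => sturmSeq n q x k

/-- With the convention that the term before index 0 is 0, one recurrence covers every step; this
lets the loop start uniformly with registers 0 and 1. -/
lemma sturmSeq_succ (n : ℕ) (q : ℝ → ℝ) (x : ℝ) (k : ℕ) :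
    sturmSeq n q x (k + 1) =
      (diagEntry n q k - x) * sturmSeq n q x k - ((n : ℝ) + 1) ^ 4 * sturmPrev n q x k := by
  cases k with
  | zero => simp [sturmSeq, sturmPrev, diagEntry]
  | succ k =>
    simp only [sturmSeq, sturmPrev, diagEntry]
    push_cast
    rw [show (k : ℝ) + 1 + 1 = k + 2 by ring]

/-- The registers hold the interval `[lo, hi]` and the diagonal of the matrix. -/
def Loaded (n : ℕ) (q : ℝ → ℝ) (I : ℝ × ℝ) (s : ℕ → ℝ) : Prop :=
  s 0 = I.1 ∧ s 1 = I.2 ∧ ∀ i < n, s (7 + i) = diagEntry n q i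

lemma Loaded.update {n : ℕ} {I : ℝ × ℝ} (h : Loaded n q I s) {d : ℕ} (hd : 2 ≤ d) (hd' : d < 7)
    (y : ℝ) : Loaded n q I (Function.update s d y) := by
  refine ⟨?_, ?_, fun i hi => ?_⟩
  · rw [Function.update_of_ne (by omega)]; exact h.1
  · rw [Function.update_of_ne (by omega)]; exact h.2.1
  · rw [Function.update_of_ne (by omega)]; exact h.2.2 i hi

/-- Each term costs five arithmetic operations, one of them a copy by adding 0, and one comparison.
Leaving at the first nonpositive term only saves operations. -/
lemma runs_sturmTree {n : ℕ} {I : ℝ × ℝ} {x : ℝ} {pos neg : ComputationTree}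
    (hpos : (∀ j ≤ n, 0 < sturmSeq n q x j) → ∀ s, Loaded n q I s → s 2 = x →
      Runs q pos s v e m)
    (hneg : ¬ (∀ j ≤ n, 0 < sturmSeq n q x j) → ∀ s, Loaded n q I s → s 2 = x →
      Runs q neg s v e m) (l k : ℕ) (hlk : k + l = n) (hs : Loaded n q I s) (h2 : s 2 = x)
    (h3 : s 3 = sturmPrev n q x k) (h4 : s 4 = sturmSeq n q x k)
    (hk : ∀ j ≤ k, 0 < sturmSeq n q x j) :
    Runs q (sturmTree n pos neg l k) s v e (m + 6 * l) := by
  induction l generalizing k s with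
  | zero =>
    obtain rfl : k = n := by omega
    exact hpos hk s hs h2
  | succ l ih =>
    have hd := hs.2.2 k (by omega)
    rw [show m + 6 * (l + 1) = (m + 6 * l) + 1 + 1 + 1 + 1 + 1 + 1 by ring, sturmTree]
    refine .arith rfl <| .arith rfl <| .arith rfl <| .arith rfl <| .arith rfl ?_
    simp only [Operand.value, Function.update_self, ne_eq,
      Nat.reduceEqDiff, not_false_eq_true, Function.update_of_ne, hd, h2, h3, h4, add_zero]
    rw [← sturmSeq_succ]
    set s' := Function.update (Function.update (Function.update (Function.update (Function.update s
      5 (diagEntry n q k - x)) 5 ((diagEntry n q k - x) * sturmSeq n q x k)) 6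
      (((n : ℝ) + 1) ^ 4 * sturmPrev n q x k)) 3 (sturmSeq n q x k)) 4 (sturmSeq n q x (k + 1))
      with hs'
    have hL : Loaded n q I s' := by
      refine .update (.update (.update (.update (.update hs ?_ ?_ _) ?_ ?_ _) ?_ ?_ _) ?_ ?_ _)
        ?_ ?_ _ <;> norm_num
    have h2' : s' 2 = x := by simp [hs', h2]
    have h3' : s' 3 = sturmPrev n q x (k + 1) := by simp [hs', sturmPrev]
    have h4' : s' 4 = sturmSeq n q x (k + 1) := by simp [hs']
    refine .compare (fun hle => ?_) fun hlt => ?_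
    · simp only [Operand.value, h4'] at hle
      exact (hneg (fun hall => (hall (k + 1) (by omega)).not_ge hle) s' hL h2').mono (by omega)
    · simp only [Operand.value, h4'] at hlt
      refine ih (k + 1) (by omega) hL h2' h3' h4' fun j hj => ?_
      rcases Nat.lt_or_ge k j with h | h
      · obtain rfl : j = k + 1 := by omega
        exact hlt
      · exact hk j h

/-- A step costs two operations for the midpoint, two to initialise the recurrence, 6n for the Sturm
terms and one to replace an endpoint; the output midpoint costs two more. -/
lemma runs_bisectTree (n k j : ℕ) (hs : Loaded n q (bisectionInterval n q j) s) :
    Runs q (bisectTree n k) s (sturmBisection n (j + k) q) 0 (k * (6 * n + 5) + 2) := by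
  have hdiv : ∀ a : ℝ, ArithOp.eval div a 2 = some (a / 2) := fun a => by simp [ArithOp.eval]
  induction k generalizing j s with
  | zero =>
    rw [bisectTree, Nat.zero_mul]
    refine .arith rfl <| .arith (hdiv _) <| .output ?_
    simp [Operand.value, hs.1, hs.2.1, sturmBisection]
  | succ k ih =>
    set x := ((bisectionInterval n q j).1 + (bisectionInterval n q j).2) / 2 with hx
    rw [show (k + 1) * (6 * n + 5) + 2 = (k * (6 * n + 5) + 2 + 1 + 6 * n) + 1 + 1 + 1 + 1 by ring,
      bisectTree]
    refine .arith rfl <| .arith (hdiv _) <| .arith rfl <| .arith rfl ?_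
    simp only [Operand.value, Function.update_self, hs.1, hs.2.1, add_zero]
    rw [← hx, show j + (k + 1) = (j + 1) + k by ring]
    refine runs_sturmTree (I := bisectionInterval n q j) (x := x) (fun hp s hL h2 => ?_)
      (fun hp s hL h2 => ?_) n 0 (by simp) ?_ (by simp) (by simp [sturmPrev])
      (by simp [sturmSeq]) (by simp [sturmSeq])
    · refine .arith rfl (ih (j + 1) ?_)
      simp only [bisectionInterval]
      rw [if_pos hp]
      refine ⟨by simp [Operand.value, h2, hx], ?_, fun i hi => ?_⟩
      · rw [Function.update_of_ne (by norm_num)]; exact hL.2.1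
      · rw [Function.update_of_ne (by omega)]; exact hL.2.2 i hi
    · refine .arith rfl (ih (j + 1) ?_)
      simp only [bisectionInterval]
      rw [if_neg hp]
      refine ⟨?_, by simp [Operand.value, h2, hx], fun i hi => ?_⟩
      · rw [Function.update_of_ne (by norm_num)]; exact hL.1
      · rw [Function.update_of_ne (by omega)]; exact hL.2.2 i hi
    · refine .update (.update (.update (.update hs ?_ ?_ _) ?_ ?_ _) ?_ ?_ _) ?_ ?_ _ <;> norm_num

lemma runs_loadTree {n : ℕ} {next : ComputationTree}
    (hnext : ∀ s, Loaded n q (0, 11) s → Runs q next s v e m) (l i : ℕ) (hli : i + l = n)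
    (h0 : s 0 = 0) (hs : ∀ j < i, s (7 + j) = diagEntry n q j) :
    Runs q (loadTree n next l i) s v (e + l) (m + 1 + l) := by
  induction l generalizing i s with
  | zero =>
    obtain rfl : i = n := by omega
    refine .arith rfl (hnext _ ⟨?_, by simp [Operand.value], fun j hj => ?_⟩)
    · rw [Function.update_of_ne (by norm_num)]; exact h0
    · rw [Function.update_of_ne (by omega)]; exact hs j hj
  | succ l ih =>
    rw [loadTree, ← Nat.add_assoc, ← Nat.add_assoc]
    refine .sample (node_mem_Icc (by omega)) <| .arith rfl <|
      ih (i + 1) (by omega) ?_ fun j hj => ?_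
    · rw [Function.update_of_ne (by omega), Function.update_of_ne (by omega)]; exact h0
    · rcases Nat.lt_or_ge j i with h | h
      · rw [Function.update_of_ne (by omega), Function.update_of_ne (by omega)]; exact hs j h
      · obtain rfl : j = i := by omega
        simp only [Operand.value, Function.update_self, diagEntry]
        ring

/-- Bisection with Sturm sequences as a computation tree. -/
def bisection (n k : ℕ) : ComputationTree := loadTree n (bisectTree n k) n 0

lemma exists_exec_bisection (n k : ℕ) (q : ℝ → ℝ) :
    ∃ r, (bisection n k).exec q = some r ∧ r.value = sturmBisection n k q ∧ r.evals = n ∧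
      r.ops ≤ k * (6 * n + 5) + 3 + n := by
  have h : Runs q (bisection n k) (fun _ => 0) (sturmBisection n k q) (0 + n)
      (k * (6 * n + 5) + 2 + 1 + n) :=
    runs_loadTree (fun s hs => by
      simpa using runs_bisectTree n k 0 (by simpa [bisectionInterval] using hs))
      n 0 (by simp) rfl (by simp)
  rwa [Nat.zero_add] at h

end ComputationTree

/-! ### Complexity bounds -/

section

variable {ε : ℝ}

lemma le_nWor (hε : 0 < ε) (hε₀ : ε ≤ 1 / 10497600) :
    ENNReal.ofReal (1 / 3240 * ε ^ (-(1 / 2) : ℝ)) ≤ (nWor ε : ℝ≥0∞) := by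
  set m := ⌈1 / 3240 * ε ^ (-(1 / 2) : ℝ)⌉₊
  -- The infimum is over extended naturals, so the real lower bound is first rounded up. The
  -- constant potential 1 alone witnesses the worst case.
  have h : (m : ℕ∞) ≤ nWor ε := by
    refine le_iInf₂ fun φ hφ => ?_
    refine le_trans ?_ (le_iSup₂ (f := fun q (_ : q ∈ potentials) => (φ.evals q : ℕ∞)) (fun _ => 1)
      one_mem_potentials)
    exact Nat.cast_le.2 (Nat.ceil_le.2 (φ.le_evals hε hε₀ hφ))
  calc ENNReal.ofReal (1 / 3240 * ε ^ (-(1 / 2) : ℝ)) ≤ ENNReal.ofReal (m : ℝ) :=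
        ENNReal.ofReal_le_ofReal (Nat.le_ceil _)
    _ = ((m : ℕ∞) : ℝ≥0∞) := by simp
    _ ≤ _ := ENat.toENNReal_le.2 h

lemma le_compWor (hε : 0 < ε) (hε₀ : ε ≤ 1 / 10497600) {c : ℝ} (hc : 0 < c) :
    ENNReal.ofReal (1 / 3240 * (c * ε ^ (-(1 / 2) : ℝ))) ≤ compWor c ε := by
  refine le_iInf₂ fun T hT => ?_
  have hle := T.sampling.le_evals hε hε₀ (ComputationTree.worstError_sampling_le hT)
  obtain ⟨r, hr, -⟩ := ComputationTree.exists_exec_of_worstError_le hT one_mem_potentials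
  rw [(ComputationTree.sampling_spec hr).2] at hle
  have hcost : ENNReal.ofReal c * (r.evals : ℝ≥0∞) + (r.ops : ℝ≥0∞) ≤ T.worstCost c := by
    have := le_iSup₂ (f := fun q (_ : q ∈ potentials) => (T.exec q).elim ⊤ fun r : Outcome =>
      ENNReal.ofReal c * (r.evals : ℝ≥0∞) + (r.ops : ℝ≥0∞)) (fun _ => 1) one_mem_potentials
    rw [hr] at this
    exact this
  refine le_trans ?_ (le_self_add.trans hcost)
  rw [← ENNReal.ofReal_natCast, ← ENNReal.ofReal_mul hc.le]
  refine ENNReal.ofReal_le_ofReal ?_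
  have := mul_le_mul_of_nonneg_left hle hc.le
  linarith

/-- Bisection with suitable parameters has error at most `ε` and the stated cost. -/
lemma exists_bisection_parameters (hε : 0 < ε) (hε₀ : ε ≤ 1 / 10497600) :
    ∃ n k : ℕ, 1 ≤ n ∧ (n : ℝ) ≤ 18 * ε ^ (-(1 / 2) : ℝ) ∧ (k : ℝ) ≤ 1620 * Real.logb 2 ε⁻¹ ∧
      ((k * (6 * n + 5) + 3 + n : ℕ) : ℝ) ≤ 1620 * (ε ^ (-(1 / 2) : ℝ) * Real.logb 2 ε⁻¹) ∧
      ∀ q ∈ potentials, |smallestEigenvalue q - sturmBisection n k q| ≤ ε := by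
  set s := ε ^ (-(1 / 2) : ℝ) with hs_def
  have hs0 : 0 < s := Real.rpow_pos_of_pos hε _
  have hs : s ^ 2 = ε⁻¹ := sq_rpow_neg_half hε
  have hinv : (2 : ℝ) ≤ ε⁻¹ := by
    rw [le_inv_comm₀ (by norm_num) hε]; linarith
  have hs1 : 1 ≤ s := by
    refine (pow_le_pow_iff_left₀ (by norm_num) hs0.le two_ne_zero).1 ?_
    rw [hs]; linarith
  set l := Real.logb 2 ε⁻¹ with hl_def
  have hl : 1 ≤ l := by
    rw [hl_def, Real.le_logb_iff_rpow_le (by norm_num) (by positivity), Real.rpow_one]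
    exact hinv
  -- 17² = 289 ≥ 2 · 132 makes the discretisation error at most ε/2.
  set n := ⌈17 * s⌉₊ with hn_def
  -- The extra 4 gives 2^k ≥ 16/ε, so the bisection error is at most 11ε/32 ≤ ε/2.
  set k := ⌈l⌉₊ + 4 with hk_def
  have hn17 : 17 * s ≤ n := Nat.le_ceil _
  have hn1 : 1 ≤ n := Nat.one_le_iff_ne_zero.2 fun h => by
    rw [h] at hn17; norm_num at hn17; linarith
  have hn18 : (n : ℝ) ≤ 18 * s := by
    have := (Nat.ceil_lt_add_one (by positivity : 0 ≤ 17 * s)).le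
    linarith
  have hk6 : (k : ℝ) ≤ 6 * l := by
    have := (Nat.ceil_lt_add_one (by positivity : 0 ≤ l)).le
    rw [hk_def]; push_cast; linarith
  have hk1 : (1 : ℝ) ≤ k := by
    rw [hk_def]; push_cast; linarith [(Nat.cast_nonneg ⌈l⌉₊ : (0 : ℝ) ≤ _)]
  have hn1' : (1 : ℝ) ≤ n := by exact_mod_cast hn1
  have hk2 : 16 * ε⁻¹ ≤ 2 ^ k := by
    have h1 : ε⁻¹ ≤ 2 ^ ⌈l⌉₊ := by
      rw [← Real.rpow_natCast, ← Real.logb_le_iff_le_rpow (by norm_num) (by positivity)]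
      exact Nat.le_ceil _
    rw [hk_def, pow_add]
    linarith
  refine ⟨n, k, hn1, hn18, by linarith, ?_, fun q hq => ?_⟩
  · have h1 : (n : ℝ) * k ≤ 18 * s * (6 * l) := by gcongr
    push_cast
    -- As n, k ≥ 1, the count is at most (6 + 5 + 3 + 1)nk = 15nk, and 15 · 18 · 6 = 1620.
    nlinarith [mul_nonneg (sub_nonneg.2 hk1) (sub_nonneg.2 hn1')]
  · have e1 := abs_smallestEigenvalue_sub_fdEigenvalue_le hq hn1
    have e2 := abs_fdEigenvalue_sub_sturmBisection_le hn1 hq.2.1 k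
    have b1 : 132 / (n : ℝ) ^ 2 ≤ ε / 2 := by
      have : 289 * ε⁻¹ ≤ (n : ℝ) ^ 2 := by
        rw [← hs]
        calc 289 * s ^ 2 = (17 * s) ^ 2 := by ring
          _ ≤ (n : ℝ) ^ 2 := by gcongr
      rw [div_le_iff₀ (by positivity)]
      have h2 := mul_le_mul_of_nonneg_left this hε.le
      have h3 : ε * (289 * ε⁻¹) = 289 := by field_simp
      linarith
    have b2 : 11 / (2 : ℝ) ^ (k + 1) ≤ ε / 2 := by
      rw [div_le_iff₀ (by positivity), pow_succ]
      have h2 := mul_le_mul_of_nonneg_left hk2 hε.le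
      have h3 : ε * (16 * ε⁻¹) = 16 := by field_simp
      linarith
    have := abs_sub_le (smallestEigenvalue q) (fdEigenvalue n q) (sturmBisection n k q)
    linarith

lemma nWor_le_of_forall {T : ComputationTree} {n : ℕ} {A : ℝ}
    (h : ∀ q ∈ potentials, ∃ r, T.exec q = some r ∧ |smallestEigenvalue q - r.value| ≤ ε ∧
      r.evals = n) (hA : (n : ℝ) ≤ A) : (nWor ε : ℝ≥0∞) ≤ ENNReal.ofReal A := by
  have herr : T.sampling.worstError ≤ ENNReal.ofReal ε := iSup₂_le fun q hq => by
    obtain ⟨r, hr, hle, -⟩ := h q hq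
    rw [(ComputationTree.sampling_spec hr).1]
    exact ENNReal.ofReal_le_ofReal hle
  have hn : nWor ε ≤ n := (iInf₂_le T.sampling herr).trans <| iSup₂_le fun q hq => by
    obtain ⟨r, hr, -, hev⟩ := h q hq
    rw [(ComputationTree.sampling_spec hr).2, hev]
  calc (nWor ε : ℝ≥0∞) ≤ ((n : ℕ∞) : ℝ≥0∞) := ENat.toENNReal_le.2 hn
    _ = ENNReal.ofReal n := by simp
    _ ≤ _ := ENNReal.ofReal_le_ofReal hA

lemma compWor_le_of_forall {T : ComputationTree} {A B c : ℝ} (hc : 0 ≤ c)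
    (h : ∀ q ∈ potentials, ∃ r, T.exec q = some r ∧ |smallestEigenvalue q - r.value| ≤ ε ∧
      (r.evals : ℝ) ≤ A ∧ (r.ops : ℝ) ≤ B) : compWor c ε ≤ ENNReal.ofReal (c * A + B) := by
  have herr : T.worstError ≤ ENNReal.ofReal ε := iSup₂_le fun q hq => by
    obtain ⟨r, hr, hle, -⟩ := h q hq
    rw [hr]
    exact ENNReal.ofReal_le_ofReal hle
  refine (iInf₂_le T herr).trans <| iSup₂_le fun q hq => ?_
  obtain ⟨r, hr, -, hA, hB⟩ := h q hq
  rw [hr]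
  simp only [Option.elim_some]
  rw [← ENNReal.ofReal_natCast, ← ENNReal.ofReal_natCast, ← ENNReal.ofReal_mul hc,
    ← ENNReal.ofReal_add (by positivity) (by positivity)]
  gcongr

end

end SturmLiouville

end

/-! ### The main theorem -/

theorem mainTheorem3 :
    -- every potential has a smallest eigenvalue
    (∀ q ∈ SturmLiouville.potentials,
      IsLeast (SturmLiouville.eigenvalues q) (SturmLiouville.smallestEigenvalue q)) ∧
    -- the finite difference matrix is accurate to order `n⁻²`, uniformly in `q`
    (∃ C : ℝ, 0 < C ∧ ∀ n : ℕ, 1 ≤ n → ∀ q ∈ SturmLiouville.potentials,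
      |SturmLiouville.smallestEigenvalue q - SturmLiouville.fdEigenvalue n q|
        ≤ C / (n : ℝ) ^ 2) ∧
    ∃ α₁ α₂ α₃ ε₀ : ℝ, 0 < α₁ ∧ 0 < α₂ ∧ 0 < α₃ ∧ 0 < ε₀ ∧
      ∀ ε : ℝ, 0 < ε → ε ≤ ε₀ →
        -- information complexity
        (ENNReal.ofReal (α₁ * ε ^ (-(1 / 2) : ℝ)) ≤ (SturmLiouville.nWor ε : ENNReal) ∧
          (SturmLiouville.nWor ε : ENNReal) ≤ ENNReal.ofReal (α₂ * ε ^ (-(1 / 2) : ℝ))) ∧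
        -- complexity, with constants that do not depend on the cost `c` of a function value
        (∀ c : ℝ, 0 < c →
          ENNReal.ofReal (α₁ * (c * ε ^ (-(1 / 2) : ℝ))) ≤ SturmLiouville.compWor c ε ∧
          SturmLiouville.compWor c ε ≤
            ENNReal.ofReal (α₂ * (c * ε ^ (-(1 / 2) : ℝ)) +
              α₃ * (ε ^ (-(1 / 2) : ℝ) * Real.logb 2 ε⁻¹))) ∧
        -- the upper bounds are achieved by bisection with Sturm sequences for the matrix
        (∃ n k : ℕ, 1 ≤ n ∧ (n : ℝ) ≤ α₂ * ε ^ (-(1 / 2) : ℝ) ∧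
          (k : ℝ) ≤ α₃ * Real.logb 2 ε⁻¹ ∧
          ∃ T : SturmLiouville.ComputationTree, ∀ q ∈ SturmLiouville.potentials,
            ∃ r : SturmLiouville.Outcome, T.exec q = some r ∧
              r.value = SturmLiouville.sturmBisection n k q ∧
              |SturmLiouville.smallestEigenvalue q - r.value| ≤ ε ∧
              r.evals = n ∧
              (r.ops : ℝ) ≤ α₃ * (ε ^ (-(1 / 2) : ℝ) * Real.logb 2 ε⁻¹)) := by
  refine ⟨fun q hq => SturmLiouville.isLeast_smallestEigenvalue hq,
    ⟨132, by norm_num, fun n hn q hq =>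
      SturmLiouville.abs_smallestEigenvalue_sub_fdEigenvalue_le hq hn⟩,
    1 / 3240, 18, 1620, 1 / 10497600, by norm_num, by norm_num, by norm_num, by norm_num,
    fun ε hε hε₀ => ?_⟩
  obtain ⟨n, k, hn, hn18, hk, hops, herr⟩ :=
    SturmLiouville.exists_bisection_parameters hε hε₀
  have hT : ∀ q ∈ SturmLiouville.potentials, ∃ r : SturmLiouville.Outcome,
      (SturmLiouville.ComputationTree.bisection n k).exec q = some r ∧
        r.value = SturmLiouville.sturmBisection n k q ∧
        |SturmLiouville.smallestEigenvalue q - r.value| ≤ ε ∧ r.evals = n ∧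
        (r.ops : ℝ) ≤ 1620 * (ε ^ (-(1 / 2) : ℝ) * Real.logb 2 ε⁻¹) := fun q hq => by
    obtain ⟨r, hr, hv, he, ho⟩ := SturmLiouville.ComputationTree.exists_exec_bisection n k q
    exact ⟨r, hr, hv, hv ▸ herr q hq, he, (Nat.cast_le.2 ho).trans hops⟩
  refine ⟨⟨SturmLiouville.le_nWor hε hε₀, SturmLiouville.nWor_le_of_forall
      (T := SturmLiouville.ComputationTree.bisection n k) (fun q hq => ?_) hn18⟩,
    fun c hc => ⟨SturmLiouville.le_compWor hε hε₀ hc, ?_⟩, n, k, hn, hn18, hk, _, hT⟩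
  · obtain ⟨r, h1, -, h2, h3, -⟩ := hT q hq
    exact ⟨r, h1, h2, h3⟩
  · rw [mul_left_comm]
    refine SturmLiouville.compWor_le_of_forall
      (T := SturmLiouville.ComputationTree.bisection n k) hc.le fun q hq => ?_
    obtain ⟨r, h1, -, h2, h3, h4⟩ := hT q hq
    exact ⟨r, h1, h2, by rwa [h3], h4⟩
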